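/- Let $k$ be a field; tensor products are over $k$. A *Hopf brace* over a $k$-coalgebra $(C,\Delta,\varepsilon)$ is a pair of Hopf algebra structures $(C,\cdot,1,\Delta,\varepsilon,S)$ and $(C,\circ,1_\circ,\Delta,\varepsilon,T)$ such that $x\circ(yz)=(x_{(1)}\circ y)\,S(x_{(2)})\,(x_{(3)}\circ z)$ for all $x,y,z\in C$; it is *cocommutative* if $C$ is. A *matched pair of Hopf algebras* $(A,H,\triangleright,\triangleleft)$ consists of Hopf algebras $A,H$ and coalgebra maps $\triangleright:H\otimes A\to A$, $\triangleleft:H\otimes A\to H$ making $A$ a left $H$-module coalgebra and $H$ a right $A$-module coalgebra, such that for all $a,b\in A$, $x,y\in H$: $x\triangleright 1=\varepsilon(x)1$, $1\triangleleft a=\varepsilon(a)1$, $x\triangleright(ab)=(x_{(1)}\triangleright a_{(1)})\bigl((x_{(2)}\triangleleft a_{(2)})\triangleright b\bigr)$, $(xy)\triangleleft a=\bigl(x\triangleleft(y_{(1)}\triangleright a_{(1)})\bigr)(y_{(2)}\triangleleft a_{(2)})$ and $x_{(1)}\triangleleft a_{(1)}\otimes x_{(2)}\triangleright a_{(2)}=x_{(2)}\triangleleft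 a_{(2)}\otimes x_{(1)}\triangleright a_{(1)}$. (1) Let $(G,H,\rightharpoonup,\leftharpoonup)$ be a matched pair of groups: a left action $\rightharpoonup$ of $H$ on the set $G$ and a right action $\leftharpoonup$ of $G$ on the set $H$ with $h\rightharpoonup(gg')=(h\rightharpoonup g)\bigl((h\leftharpoonup g)\rightharpoonup g'\bigr)$ and $(hh')\leftharpoonup g=\bigl(h\leftharpoonup(h'\rightharpoonup g)\bigr)(h'\leftharpoonup g)$. Then the group Hopf algebras $A=k[G]$ and $K=k[H]$ are cocommutative, and there is exactly one matched pair of Hopf algebras $(A,K,\triangleright,\triangleleft)$ with $h\triangleright g=h\rightharpoonup g$ and $h\triangleleft g=h\leftharpoonup g$ for all $g\in G$, $h\in H$. (2) Let $(\mathfrak g,\mathfrak h,\triangleright,\triangleleft)$ be a matched pair of Lie algebras over $k$ (of arbitrary dimension): a left Lie action $\triangleright$ of $\mathfrak h$ on the vector space $\mathfrak g$ and a right Lie action $\triangleleft$ of $\mathfrak g$ on the vector space $\mathfrak h$ with $x\triangleright[a,b]=[x\triangleright a,b]+[a,x\triangleright b]+(x\triangleleft a)\triangleright b-(x\triangleleft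 b)\triangleright a$ and $[x,y]\triangleleft a=[x\triangleleft a,y]+[x,y\triangleleft a]+x\triangleleft(y\triangleright a)-y\triangleleft(x\triangleright a)$. Then the enveloping Hopf algebras $A=U(\mathfrak g)$ and $K=U(\mathfrak h)$ are cocommutative, and there is exactly one matched pair of Hopf algebras $(A,K,\triangleright,\triangleleft)$ that restricts to the given actions on (the images of) $\mathfrak h\otimes\mathfrak g$. In both cases the tensor product coalgebra $A\otimes K$ is a cocommutative Hopf brace with respect to the two multiplications $$(a\otimes x)(b\otimes y)=a(x_{(1)}\triangleright b_{(1)})\otimes(x_{(2)}\triangleleft b_{(2)})y,\qquad (a\otimes x)\circ(b\otimes y)=ab\otimes yx .$$ -/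

import Mathlib

open scoped TensorProduct

noncomputable section

/-! ### Hopf algebra structures on a fixed coalgebra, Hopf braces -/

/-- A Hopf algebra structure on the coalgebra `C` over `k`: an associative unital `k`-bilinear
multiplication for which `Δ` and `ε` are unital algebra maps, together with an antipode.
(`HopfStructure.ofHopfAlgebra` and `HopfStructure.toHopfAlgebra` below compare this
with the class `HopfAlgebra`; a structure is needed because a Hopf brace carries two
multiplications on one coalgebra.) -/
structure HopfStructure (k : Type*) (C : Type*) [Field k] [AddCommMonoid C] [Module k C]
    [Coalgebra k C] where
  /-- the multiplication -/
  mul : C →ₗ[k] C →ₗ[k] C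
  /-- the unit element -/
  one : C
  /-- the antipode -/
  antipode : C →ₗ[k] C
  mul_assoc : ∀ x y z : C, mul (mul x y) z = mul x (mul y z)
  one_mul : ∀ x : C, mul one x = x
  mul_one : ∀ x : C, mul x one = x
  comul_mul : ∀ x y : C, Coalgebra.comul (R := k) (mul x y) =
    TensorProduct.map₂ mul mul (Coalgebra.comul (R := k) x) (Coalgebra.comul (R := k) y)
  comul_one : Coalgebra.comul (R := k) one = one ⊗ₜ[k] one
  counit_mul : ∀ x y : C, Coalgebra.counit (R := k) (mul x y) =
    Coalgebra.counit (R := k) x * Coalgebra.counit (R := k) y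
  counit_one : Coalgebra.counit (R := k) one = 1
  /-- `S(x₁) x₂ = ε(x) 1` -/
  antipode_mul : ∀ x : C, TensorProduct.lift mul
    (antipode.rTensor C (Coalgebra.comul (R := k) x)) = Coalgebra.counit (R := k) x • one
  /-- `x₁ S(x₂) = ε(x) 1` -/
  mul_antipode : ∀ x : C, TensorProduct.lift mul
    (antipode.lTensor C (Coalgebra.comul (R := k) x)) = Coalgebra.counit (R := k) x • one

/-- The Hopf structure underlying a Hopf algebra. -/
def HopfStructure.ofHopfAlgebra (k A : Type*) [Field k] [Semiring A] [HopfAlgebra k A] :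
    HopfStructure k A where
  mul := LinearMap.mul k A
  one := 1
  antipode := HopfAlgebra.antipode k
  mul_assoc x y z := by simp [_root_.mul_assoc]
  one_mul x := by simp
  mul_one x := by simp
  comul_mul x y := by
    simp only [LinearMap.mul_apply', Bialgebra.comul_mul]
    induction Coalgebra.comul (R := k) x using TensorProduct.induction_on with
    | zero => simp
    | add p q hp hq => simp [add_mul, hp, hq]
    | tmul a b =>
      induction Coalgebra.comul (R := k) y using TensorProduct.induction_on with
      | zero => simp
      | add p q hp hq => simp [mul_add, hp, hq]
      | tmul c d => simp
  comul_one := by simp [Algebra.TensorProduct.one_def]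
  counit_mul x y := by simp
  counit_one := by simp
  antipode_mul x := by
    rw [← Algebra.algebraMap_eq_smul_one]
    exact HopfAlgebra.mul_antipode_rTensor_comul_apply x
  mul_antipode x := by
    rw [← Algebra.algebraMap_eq_smul_one]
    exact HopfAlgebra.mul_antipode_lTensor_comul_apply x

/-- The multiplication of a Hopf structure as a semiring structure on the carrier. -/
@[reducible] def HopfStructure.toSemiring {k C : Type*} [Field k] [i : AddCommMonoid C]
    [Module k C] [Coalgebra k C] (S : HopfStructure k C) : Semiring C where
  __ := i
  mul x y := S.mul x y
  one := S.one
  mul_assoc := S.mul_assoc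
  one_mul := S.one_mul
  mul_one := S.mul_one
  zero_mul x := by change S.mul 0 x = 0; simp
  mul_zero x := by change S.mul x 0 = 0; simp
  left_distrib x y z := by change S.mul x (y + z) = S.mul x y + S.mul x z; simp
  right_distrib x y z := by change S.mul (x + y) z = S.mul x z + S.mul y z; simp

/-- The algebra structure of a Hopf structure. -/
@[reducible] def HopfStructure.toAlgebra {k C : Type*} [Field k] [AddCommMonoid C]
    [m : Module k C] [Coalgebra k C] (S : HopfStructure k C) :
    letI := S.toSemiring; Algebra k C :=
  letI := S.toSemiring
  letI : Module k C := m
  Algebra.ofModule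
    (fun r x y => by change S.mul (r • x) y = r • S.mul x y; simp)
    (fun r x y => by change S.mul x (r • y) = r • S.mul x y; simp)

/-- A Hopf structure makes the coalgebra a Hopf algebra. -/
@[reducible] def HopfStructure.toHopfAlgebra {k C : Type*} [Field k] [AddCommMonoid C]
    [Module k C] [c : Coalgebra k C] (S : HopfStructure k C) :
    letI := S.toSemiring; HopfAlgebra k C :=
  letI := S.toSemiring
  letI := S.toAlgebra
  letI : Coalgebra k C := c
  letI : Bialgebra k C := Bialgebra.ofAlgHom
    (AlgHom.ofLinearMap (Coalgebra.comul (R := k) (A := C)) S.comul_one (fun x y => by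
      refine (S.comul_mul x y).trans ?_
      induction Coalgebra.comul (R := k) x using TensorProduct.induction_on with
      | zero => simp
      | add p q hp hq => simp [add_mul, hp, hq]
      | tmul a b =>
        induction Coalgebra.comul (R := k) y using TensorProduct.induction_on with
        | zero => simp
        | add p q hp hq => exact (map_add _ p q).trans ((congrArg₂ _ hp hq).trans (mul_add _ p q).symm)
        | tmul c d =>
          refine Eq.trans ?_ (Algebra.TensorProduct.tmul_mul_tmul a c b d).symm
          simp only [TensorProduct.map₂_apply_tmul, TensorProduct.map_tmul]
          rfl))
    (AlgHom.ofLinearMap (Coalgebra.counit (R := k) (A := C)) S.counit_one S.counit_mul)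
    (by ext x; exact Coalgebra.coassoc_apply x)
    (by ext x; exact Coalgebra.rTensor_counit_comul x)
    (by ext x; exact Coalgebra.lTensor_counit_comul x)
  { antipode := S.antipode
    mul_antipode_rTensor_comul := by
      ext x
      refine (S.antipode_mul x).trans ?_
      exact (Algebra.algebraMap_eq_smul_one _).symm
    mul_antipode_lTensor_comul := by
      ext x
      refine (S.mul_antipode x).trans ?_
      exact (Algebra.algebraMap_eq_smul_one _).symm }

/-- A Hopf brace over the coalgebra `C`: two Hopf algebra structures `·` (`dot`, with antipode `S`)
and `∘` (`circ`) on the coalgebra `C` with `x ∘ (y z) = (x₁ ∘ y) S(x₂) (x₃ ∘ z)`. -/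
structure HopfBrace (k : Type*) (C : Type*) [Field k] [AddCommMonoid C] [Module k C]
    [Coalgebra k C] where
  /-- the first Hopf algebra structure -/
  dot : HopfStructure k C
  /-- the second Hopf algebra structure -/
  circ : HopfStructure k C
  circ_dot : ∀ x y z : C, circ.mul x (dot.mul y z) =
    TensorProduct.lift dot.mul
      (TensorProduct.map (circ.mul.flip y)
        (TensorProduct.lift dot.mul ∘ₗ TensorProduct.map dot.antipode (circ.mul.flip z))
        ((Coalgebra.comul (R := k)).lTensor C (Coalgebra.comul (R := k) x)))

/-- A Hopf brace is cocommutative if its underlying coalgebra is. -/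
def HopfBrace.IsCocommutative {k C : Type*} [Field k] [AddCommMonoid C] [Module k C]
    [Coalgebra k C] (_B : HopfBrace k C) : Prop :=
  Coalgebra.IsCocomm k C

/-! ### Matched pairs of Hopf algebras -/

/-- `x ⊗ a ↦ (x₁ ▷ a₁) ⊗ (x₂ ◁ a₂)`, for linear maps `▷ : H ⊗ A → A` and `◁ : H ⊗ A → H`.
The comultiplication on the right is the one of the tensor product coalgebra `H ⊗ A`,
that is `x ⊗ a ↦ (x₁ ⊗ a₁) ⊗ (x₂ ⊗ a₂)`. -/
def actTwist {k A H : Type*} [Field k] [Semiring A] [Semiring H] [HopfAlgebra k A]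
    [HopfAlgebra k H] (l : H ⊗[k] A →ₗ[k] A) (r : H ⊗[k] A →ₗ[k] H) :
    H ⊗[k] A →ₗ[k] A ⊗[k] H :=
  TensorProduct.map l r ∘ₗ Coalgebra.comul

/-- A matched pair of Hopf algebras `(A, H, ◁, ▷)`. -/
@[ext]
structure HopfMatchedPair (k A H : Type*) [Field k] [Semiring A] [Semiring H] [HopfAlgebra k A]
    [HopfAlgebra k H] where
  /-- the coalgebra map `▷ : H ⊗ A → A`, written `lact (x ⊗ a) = x ▷ a` -/
  lact : H ⊗[k] A →ₗc[k] A
  /-- the coalgebra map `◁ : H ⊗ A → H`, written `ract (x ⊗ a) = x ◁ a` -/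
  ract : H ⊗[k] A →ₗc[k] H
  one_lact : ∀ a : A, lact (1 ⊗ₜ a) = a
  mul_lact : ∀ (x y : H) (a : A), lact ((x * y) ⊗ₜ a) = lact (x ⊗ₜ lact (y ⊗ₜ a))
  ract_one : ∀ x : H, ract (x ⊗ₜ 1) = x
  ract_mul : ∀ (x : H) (a b : A), ract (x ⊗ₜ (a * b)) = ract (ract (x ⊗ₜ a) ⊗ₜ b)
  /-- `x ▷ 1 = ε(x) 1` -/
  lact_one : ∀ x : H, lact (x ⊗ₜ 1) = Coalgebra.counit (R := k) x • (1 : A)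
  /-- `1 ◁ a = ε(a) 1` -/
  one_ract : ∀ a : A, ract (1 ⊗ₜ a) = Coalgebra.counit (R := k) a • (1 : H)
  /-- `x ▷ (a b) = (x₁ ▷ a₁) ((x₂ ◁ a₂) ▷ b)` -/
  lact_mul : ∀ (x : H) (a b : A), lact (x ⊗ₜ (a * b)) =
    LinearMap.mul' k A (((lact : H ⊗[k] A →ₗ[k] A) ∘ₗ (TensorProduct.mk k H A).flip b).lTensor A
      (actTwist (lact : H ⊗[k] A →ₗ[k] A) (ract : H ⊗[k] A →ₗ[k] H) (x ⊗ₜ a)))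
  /-- `(x y) ◁ a = (x ◁ (y₁ ▷ a₁)) (y₂ ◁ a₂)` -/
  mul_ract : ∀ (x y : H) (a : A), ract ((x * y) ⊗ₜ a) =
    LinearMap.mul' k H (((ract : H ⊗[k] A →ₗ[k] H) ∘ₗ TensorProduct.mk k H A x).rTensor H
      (actTwist (lact : H ⊗[k] A →ₗ[k] A) (ract : H ⊗[k] A →ₗ[k] H) (y ⊗ₜ a)))
  /-- `x₁ ◁ a₁ ⊗ x₂ ▷ a₂ = x₂ ◁ a₂ ⊗ x₁ ▷ a₁` -/
  ract_lact_comm : ∀ (x : H) (a : A),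
    TensorProduct.map (ract : H ⊗[k] A →ₗ[k] H) (lact : H ⊗[k] A →ₗ[k] A)
        (Coalgebra.comul (R := k) (x ⊗ₜ[k] a)) =
      TensorProduct.comm k A H
        (actTwist (lact : H ⊗[k] A →ₗ[k] A) (ract : H ⊗[k] A →ₗ[k] H) (x ⊗ₜ a))

/-- The product `(a ⊗ x) (b ⊗ y) = a (x₁ ▷ b₁) ⊗ (x₂ ◁ b₂) y` of the bicrossed product. -/
def HopfMatchedPair.bicrossedMul {k A H : Type*} [Field k] [Semiring A] [Semiring H]
    [HopfAlgebra k A] [HopfAlgebra k H] (P : HopfMatchedPair k A H) (a : A) (x : H) (b : A)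
    (y : H) : A ⊗[k] H :=
  TensorProduct.map (LinearMap.mulLeft k a) (LinearMap.mulRight k y)
    (actTwist (P.lact : H ⊗[k] A →ₗ[k] A) (P.ract : H ⊗[k] A →ₗ[k] H) (x ⊗ₜ b))

/-! ### Matched pairs of groups and of Lie algebras -/

/-- A matched pair of groups `(G, H, ⇀, ↼)`: a left action `⇀` of `H` on the set `G` and a right
action `↼` of `G` on the set `H`, with `h ⇀ (g g') = (h ⇀ g) ((h ↼ g) ⇀ g')` and
`(h h') ↼ g = (h ↼ (h' ⇀ g)) (h' ↼ g)`. -/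
structure GroupMatchedPair (G H : Type*) [Group G] [Group H] where
  /-- `lact h g = h ⇀ g` -/
  lact : H → G → G
  /-- `ract h g = h ↼ g` -/
  ract : H → G → H
  one_lact : ∀ g, lact 1 g = g
  mul_lact : ∀ h h' g, lact (h * h') g = lact h (lact h' g)
  ract_one : ∀ h, ract h 1 = h
  ract_mul : ∀ h g g', ract h (g * g') = ract (ract h g) g'
  lact_mul : ∀ h g g', lact h (g * g') = lact h g * lact (ract h g) g'
  mul_ract : ∀ h h' g, ract (h * h') g = ract h (lact h' g) * ract h' g

/-- The normalisation `h ⇀ 1 = 1` is automatic. -/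
theorem GroupMatchedPair.lact_one {G H : Type*} [Group G] [Group H] (M : GroupMatchedPair G H)
    (h : H) : M.lact h 1 = 1 := by
  have := M.lact_mul h 1 1
  rwa [M.ract_one, _root_.mul_one, left_eq_mul] at this

/-- The normalisation `1 ↼ g = 1` is automatic. -/
theorem GroupMatchedPair.one_ract {G H : Type*} [Group G] [Group H] (M : GroupMatchedPair G H)
    (g : G) : M.ract 1 g = 1 := by
  have := M.mul_ract 1 1 g
  rwa [M.one_lact, _root_.mul_one, left_eq_mul] at this

/-- A matched pair of Lie algebras `(𝔤, 𝔥, ▷, ◁)`: a left Lie action `▷` of `𝔥` on the vector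
space `𝔤` and a right Lie action `◁` of `𝔤` on the vector space `𝔥`, with
`x ▷ [a, b] = [x ▷ a, b] + [a, x ▷ b] + (x ◁ a) ▷ b - (x ◁ b) ▷ a` and
`[x, y] ◁ a = [x ◁ a, y] + [x, y ◁ a] + x ◁ (y ▷ a) - y ◁ (x ▷ a)`. -/
structure LieMatchedPair (k 𝔤 𝔥 : Type*) [Field k] [LieRing 𝔤] [LieAlgebra k 𝔤] [LieRing 𝔥]
    [LieAlgebra k 𝔥] where
  /-- `lact x a = x ▷ a` -/
  lact : 𝔥 →ₗ[k] 𝔤 →ₗ[k] 𝔤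
  /-- `ract x a = x ◁ a` -/
  ract : 𝔥 →ₗ[k] 𝔤 →ₗ[k] 𝔥
  lie_lact : ∀ x y a, lact ⁅x, y⁆ a = lact x (lact y a) - lact y (lact x a)
  ract_lie : ∀ x a b, ract x ⁅a, b⁆ = ract (ract x a) b - ract (ract x b) a
  lact_lie : ∀ x a b, lact x ⁅a, b⁆ =
    ⁅lact x a, b⁆ + ⁅a, lact x b⁆ + lact (ract x a) b - lact (ract x b) a
  lie_ract : ∀ x y a, ract ⁅x, y⁆ a =
    ⁅ract x a, y⁆ + ⁅x, ract y a⁆ + ract x (lact y a) - ract y (lact x a)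

/-! ### The Hopf algebra structure of a universal enveloping algebra -/

namespace UniversalEnvelopingAlgebra

section

attribute [local instance] LieRing.ofAssociativeRing

variable (R L : Type*) [CommRing R] [LieRing L] [LieAlgebra R L]

/-- The comultiplication of `U(L)`: the algebra map with `x ↦ x ⊗ 1 + 1 ⊗ x` for `x ∈ L`. -/
def comulHom : UniversalEnvelopingAlgebra R L →ₐ[R]
    UniversalEnvelopingAlgebra R L ⊗[R] UniversalEnvelopingAlgebra R L :=
  lift R
    { toFun := fun x => ι R x ⊗ₜ 1 + 1 ⊗ₜ ι R x
      map_add' := fun x y => by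
        simp only [map_add, TensorProduct.add_tmul, TensorProduct.tmul_add]; abel
      map_smul' := fun r x => by
        simp [TensorProduct.smul_tmul']
      map_lie' := fun {x y} => by
        simp only [LieHom.map_lie, LieRing.of_associative_ring_bracket, add_mul, mul_add,
          Algebra.TensorProduct.tmul_mul_tmul, one_mul, mul_one, TensorProduct.sub_tmul,
          TensorProduct.tmul_sub]
        abel }

/-- The counit of `U(L)`: the algebra map with `x ↦ 0` for `x ∈ L`. -/
def counitHom : UniversalEnvelopingAlgebra R L →ₐ[R] R := lift R 0

/-- The antipode of `U(L)`, as an algebra map to the opposite algebra: `x ↦ -x` for `x ∈ L`. -/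
def antipodeHom : UniversalEnvelopingAlgebra R L →ₐ[R] (UniversalEnvelopingAlgebra R L)ᵐᵒᵖ :=
  lift R
    { toFun := fun x => MulOpposite.op (-ι R x)
      map_add' := fun x y => by simp [add_comm]
      map_smul' := fun r x => by simp
      map_lie' := fun {x y} => by
        simp [LieRing.of_associative_ring_bracket, ← MulOpposite.op_mul] }

@[simp] theorem comulHom_ι (x : L) : comulHom R L (ι R x) = ι R x ⊗ₜ 1 + 1 ⊗ₜ ι R x :=
  lift_ι_apply R _ x

@[simp] theorem counitHom_ι (x : L) : counitHom R L (ι R x) = 0 :=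
  lift_ι_apply R _ x

@[simp] theorem antipodeHom_ι (x : L) : antipodeHom R L (ι R x) = MulOpposite.op (-ι R x) :=
  lift_ι_apply R _ x

/-- Induction: a property that holds on scalars and on `L`, and is stable under sums and products,
holds on `U(L)`. -/
theorem induction_ι {p : UniversalEnvelopingAlgebra R L → Prop}
    (hr : ∀ r, p (algebraMap R _ r)) (hι : ∀ x, p (ι R x)) (hadd : ∀ a b, p a → p b → p (a + b))
    (hmul : ∀ a b, p a → p b → p (a * b)) (a : UniversalEnvelopingAlgebra R L) : p a := by
  let S : Subalgebra R (UniversalEnvelopingAlgebra R L) :=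
    { carrier := {a | p a}
      mul_mem' := fun {a b} => hmul a b
      add_mem' := fun {a b} => hadd a b
      algebraMap_mem' := hr }
  let f : L →ₗ⁅R⁆ S :=
    { toFun := fun x => ⟨ι R x, hι x⟩
      map_add' := fun x y => Subtype.ext (by simp)
      map_smul' := fun r x => Subtype.ext (by simp)
      map_lie' := fun {x y} => Subtype.ext (by
        simp [LieRing.of_associative_ring_bracket]) }
  have h : S.val.comp (lift R f) = AlgHom.id R _ := by
    ext x
    simp [f]
  have h2 := DFunLike.congr_fun h a
  have h3 : ((lift R f a : S) : UniversalEnvelopingAlgebra R L) = a := h2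
  rw [← h3]
  exact (lift R f a).2

instance instBialgebra : Bialgebra R (UniversalEnvelopingAlgebra R L) :=
  Bialgebra.ofAlgHom (comulHom R L) (counitHom R L)
    (by
      ext x
      simp [-ι_apply, TensorProduct.add_tmul, TensorProduct.tmul_add,
        Algebra.TensorProduct.one_def, add_assoc])
    (by
      refine AlgHom.ext fun a => ?_
      induction a using induction_ι R L with
      | hr r => simp
      | hι x => simp [-ι_apply]
      | hadd a b ha hb => simp only [map_add, ha, hb]
      | hmul a b ha hb => simp only [map_mul, ha, hb])
    (by ext x; simp [-ι_apply])

/-- The antipode of `U(L)` as a linear map. -/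
def antipodeMap : UniversalEnvelopingAlgebra R L →ₗ[R] UniversalEnvelopingAlgebra R L :=
  (MulOpposite.opLinearEquiv R).symm.toLinearMap ∘ₗ (antipodeHom R L).toLinearMap

@[simp] theorem antipodeMap_ι (x : L) : antipodeMap R L (ι R x) = -ι R x := by
  simp [-ι_apply, antipodeMap]

@[simp] theorem antipodeMap_one : antipodeMap R L 1 = 1 := by
  simp [antipodeMap]

theorem antipodeMap_mul (a b : UniversalEnvelopingAlgebra R L) :
    antipodeMap R L (a * b) = antipodeMap R L b * antipodeMap R L a := by
  simp [antipodeMap]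

theorem mul'_rTensor_mul {r : R}
    {w : UniversalEnvelopingAlgebra R L ⊗[R] UniversalEnvelopingAlgebra R L}
    (hw : LinearMap.mul' R _ ((antipodeMap R L).rTensor _ w) = algebraMap R _ r)
    (z : UniversalEnvelopingAlgebra R L ⊗[R] UniversalEnvelopingAlgebra R L) :
    LinearMap.mul' R _ ((antipodeMap R L).rTensor _ (w * z)) =
      r • LinearMap.mul' R _ ((antipodeMap R L).rTensor _ z) := by
  induction z using TensorProduct.induction_on with
  | zero => simp
  | add p q hp hq => simp [mul_add, hp, hq]
  | tmul c d =>
    have key : ∀ w : UniversalEnvelopingAlgebra R L ⊗[R] UniversalEnvelopingAlgebra R L,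
        LinearMap.mul' R _ ((antipodeMap R L).rTensor _ (w * (c ⊗ₜ d))) =
          antipodeMap R L c * LinearMap.mul' R _ ((antipodeMap R L).rTensor _ w) * d := by
      intro w
      induction w using TensorProduct.induction_on with
      | zero => simp
      | add p q hp hq => simp only [add_mul, mul_add, map_add, hp, hq]
      | tmul a b => simp [antipodeMap_mul, mul_assoc]
    rw [key, hw, ← Algebra.commutes, Algebra.algebraMap_eq_smul_one]
    simp

theorem mul'_lTensor_mul {r : R}
    {z : UniversalEnvelopingAlgebra R L ⊗[R] UniversalEnvelopingAlgebra R L}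
    (hz : LinearMap.mul' R _ ((antipodeMap R L).lTensor _ z) = algebraMap R _ r)
    (w : UniversalEnvelopingAlgebra R L ⊗[R] UniversalEnvelopingAlgebra R L) :
    LinearMap.mul' R _ ((antipodeMap R L).lTensor _ (w * z)) =
      r • LinearMap.mul' R _ ((antipodeMap R L).lTensor _ w) := by
  induction w using TensorProduct.induction_on with
  | zero => simp
  | add p q hp hq => simp [add_mul, hp, hq]
  | tmul c d =>
    have key : ∀ z : UniversalEnvelopingAlgebra R L ⊗[R] UniversalEnvelopingAlgebra R L,
        LinearMap.mul' R _ ((antipodeMap R L).lTensor _ ((c ⊗ₜ d) * z)) =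
          c * LinearMap.mul' R _ ((antipodeMap R L).lTensor _ z) * antipodeMap R L d := by
      intro z
      induction z using TensorProduct.induction_on with
      | zero => simp
      | add p q hp hq => simp only [add_mul, mul_add, map_add, hp, hq]
      | tmul a b => simp [antipodeMap_mul, mul_assoc]
    rw [key, hz, ← Algebra.commutes, Algebra.algebraMap_eq_smul_one]
    simp

instance instHopfAlgebra : HopfAlgebra R (UniversalEnvelopingAlgebra R L) where
  antipode := antipodeMap R L
  mul_antipode_rTensor_comul := by
    refine LinearMap.ext fun a => ?_
    change LinearMap.mul' R _ ((antipodeMap R L).rTensor _ (comulHom R L a)) =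
      algebraMap R _ (counitHom R L a)
    induction a using induction_ι R L with
    | hr r => simp [Algebra.TensorProduct.one_def, Algebra.algebraMap_eq_smul_one]
    | hι x => simp [-ι_apply]
    | hadd a b ha hb => simp only [map_add, ha, hb]
    | hmul a b ha hb =>
      rw [map_mul, mul'_rTensor_mul R L ha, hb, map_mul, map_mul, Algebra.smul_def]
  mul_antipode_lTensor_comul := by
    refine LinearMap.ext fun a => ?_
    change LinearMap.mul' R _ ((antipodeMap R L).lTensor _ (comulHom R L a)) =
      algebraMap R _ (counitHom R L a)
    induction a using induction_ι R L with
    | hr r => simp [Algebra.TensorProduct.one_def, Algebra.algebraMap_eq_smul_one]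
    | hι x => simp [-ι_apply]
    | hadd a b ha hb => simp only [map_add, ha, hb]
    | hmul a b ha hb =>
      rw [map_mul, mul'_lTensor_mul R L hb, ha, map_mul, map_mul, Algebra.smul_def,
        ← Algebra.commutes]

end

end UniversalEnvelopingAlgebra

end

noncomputable section

open Coalgebra TensorProduct

/-! Write E for A ⊗ H with a bialgebra multiplication extending those of A and H and with (a ⊗ 1)(1
⊗ x) = a ⊗ x. Everything reduces to constructing E. The map x ⊗ a ↦ (1 ⊗ x)(a ⊗ 1) is a coalgebra
map H ⊗ A → A ⊗ H, so it is recovered from its two components, which are the actions: it equals x₁ ▷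
a₁ ⊗ x₂ ◁ a₂. The matched pair axioms are then the two projections of unitality and associativity in
E, and the exchange condition holds because H ⊗ A is cocommutative (`BicrossedProduct.matchedPair`).

The brace identity is a computation in E. The second product is two-sided multiplication, (a ⊗ x) ∘
w = a w x (`circMul_tmul_left`), and the antipode of E is S(a ⊗ x) = S(x) S(a). Hence for u = a ⊗ x
the right side of the identity is a₁ v x₁ · S(x₂) S(a₂) · a₃ w x₃ = a v x₁ S(x₂) w x₃ = a v w x,
which is u ∘ (v w) (`circMul_mul`). Cocommutativity of H makes S an antipode for the opposite
product as well.

For groups, E is the linear extension of the Zappa–Szép product on the basis G × H, and an action is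
determined by its values on that basis.

For Lie algebras, E is built by an action of 𝔥 on W = U(𝔤) ⊗ U(𝔥), without bases or a PBW theorem.
The action must satisfy x(1 ⊗ y) = 1 ⊗ xy and x(a w) = (x ▷ a) w + a (x w) + (x ◁ a) w. This
recursion over U(𝔤) is well defined because it is the second component of a representation of 𝔤 on W
× Hom(𝔥, W), acting on pairs (w, x ↦ x w) (`prodActionHom`, `act_inl_mul`). Two of the matched pair
axioms make that a representation of 𝔤; the other two make W a representation of 𝔥 (`actHom`). The
product is (a ⊗ x) w = a (x w). Uniqueness (`hopfMatchedPair_ext`) follows since the module axioms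
and product rules propagate the values on 𝔥 ⊗ 𝔤 to all of U(𝔥) ⊗ U(𝔤). -/

/-- A multiplication on the tensor product coalgebra of two Hopf algebras `A` and `H` which makes it a
bialgebra containing `A` and `H`, and for which `(a ⊗ 1) (1 ⊗ x) = a ⊗ x`. -/
structure BicrossedProduct (k A H : Type*) [Field k] [Semiring A] [Semiring H] [HopfAlgebra k A]
    [HopfAlgebra k H] where
  /-- the multiplication -/
  mul : A ⊗[k] H →ₗ[k] A ⊗[k] H →ₗ[k] A ⊗[k] H
  mul_assoc : ∀ u v w, mul (mul u v) w = mul u (mul v w)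
  tmul_one_mul : ∀ a w, mul (a ⊗ₜ 1) w = (a ⊗ₜ 1) * w
  mul_one_tmul : ∀ w y, mul w (1 ⊗ₜ y) = w * (1 ⊗ₜ y)
  comul_mul : ∀ u v, comul (R := k) (mul u v) =
    TensorProduct.map₂ mul mul (comul (R := k) u) (comul (R := k) v)
  counit_mul : ∀ u v, counit (R := k) (mul u v) = counit (R := k) u * counit (R := k) v

/-! ### The tensor product coalgebra and its two projections -/

section TensorCoalgebra

variable {k A H : Type*} [Field k] [Semiring A] [Semiring H] [HopfAlgebra k A] [HopfAlgebra k H]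

variable (k A H) in
/-- The projection `id ⊗ ε : A ⊗ H → A` of the tensor product coalgebra. -/
def tensorFst : A ⊗[k] H →ₗc[k] A :=
  (Coalgebra.TensorProduct.rid k k A : A ⊗[k] k →ₗc[k] A).comp
    (Coalgebra.TensorProduct.map (CoalgHom.id k A) (Coalgebra.counitCoalgHom k H))

variable (k A H) in
/-- The projection `ε ⊗ id : A ⊗ H → H` of the tensor product coalgebra. -/
def tensorSnd : A ⊗[k] H →ₗc[k] H :=
  (Coalgebra.TensorProduct.lid k H : k ⊗[k] H →ₗc[k] H).comp
    (Coalgebra.TensorProduct.map (Coalgebra.counitCoalgHom k A) (CoalgHom.id k H))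

@[simp] theorem tensorFst_tmul (a : A) (x : H) :
    tensorFst k A H (a ⊗ₜ x) = counit (R := k) x • a := rfl

@[simp] theorem tensorSnd_tmul (a : A) (x : H) :
    tensorSnd k A H (a ⊗ₜ x) = counit (R := k) a • x := rfl

/-- By the counit laws, a₁ ε(x₁) ⊗ ε(a₂) x₂ = a ⊗ x. Consequently a coalgebra map into A ⊗ H is
determined by its two components. -/
theorem map_tensorFst_tensorSnd_comul (w : A ⊗[k] H) :
    TensorProduct.map (tensorFst k A H : A ⊗[k] H →ₗ[k] A)
      (tensorSnd k A H : A ⊗[k] H →ₗ[k] H) (comul w) = w := by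
  induction w with
  | zero => simp
  | add u v hu hv => rw [map_add, map_add, hu, hv]
  | tmul a x =>
    -- Arbitrary tensors p, q stand for Δ(a), Δ(x), so that induction on pure tensors can replace
    -- Sweedler notation. The later `key` statements use the same device.
    have key : ∀ (p : A ⊗[k] A) (q : H ⊗[k] H),
        TensorProduct.map (tensorFst k A H : A ⊗[k] H →ₗ[k] A)
          (tensorSnd k A H : A ⊗[k] H →ₗ[k] H) (tensorTensorTensorComm k A A H H (p ⊗ₜ q)) =
        TensorProduct.rid k A (counit.lTensor A p) ⊗ₜ
          TensorProduct.lid k H (counit.rTensor H q) := by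
      intro p q
      induction p with
      | zero => simp
      | add u v hu hv => simp only [add_tmul, map_add, hu, hv]
      | tmul a a' =>
        induction q with
        | zero => simp
        | add u v hu hv => simp only [tmul_add, map_add, hu, hv]
        | tmul x x' => simp [smul_tmul', tmul_smul, smul_smul, mul_comm]
    have := key (comul a) (comul x)
    rw [Coalgebra.lTensor_counit_comul, Coalgebra.rTensor_counit_comul] at this
    rw [TensorProduct.comul_tmul]
    refine Eq.trans ?_ (this.trans ?_)
    · rfl
    · simp

theorem comul_tmul_eq (a : A) (x : H) : comul (R := k) (a ⊗ₜ[k] x) =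
    tensorTensorTensorComm k A A H H (comul (R := k) a ⊗ₜ comul (R := k) x) := rfl

theorem comul_tmul_one (a : A) : comul (R := k) (a ⊗ₜ[k] (1 : H)) =
    TensorProduct.map ((TensorProduct.mk k A H).flip 1) ((TensorProduct.mk k A H).flip 1)
      (comul a) := by
  rw [comul_tmul_eq, Bialgebra.comul_one]
  induction (comul a : A ⊗[k] A) with
  | zero => simp
  | add u v hu hv => simp only [add_tmul, map_add, hu, hv]
  | tmul a b => simp [Algebra.TensorProduct.one_def]

theorem comul_one_tmul (x : H) : comul (R := k) ((1 : A) ⊗ₜ[k] x) =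
    TensorProduct.map (TensorProduct.mk k A H 1) (TensorProduct.mk k A H 1) (comul x) := by
  rw [comul_tmul_eq, Bialgebra.comul_one]
  induction (comul x : H ⊗[k] H) with
  | zero => simp
  | add u v hu hv => simp only [tmul_add, map_add, hu, hv]
  | tmul a b => simp [Algebra.TensorProduct.one_def]

end TensorCoalgebra

/-! ### From a bicrossed product to a matched pair -/

namespace BicrossedProduct

variable {k A H : Type*} [Field k] [Semiring A] [Semiring H] [HopfAlgebra k A] [HopfAlgebra k H]
  (E : BicrossedProduct k A H)

theorem one_mul (w : A ⊗[k] H) : E.mul (1 ⊗ₜ 1) w = w := by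
  rw [E.tmul_one_mul, ← Algebra.TensorProduct.one_def, _root_.one_mul]

theorem mul_one (w : A ⊗[k] H) : E.mul w (1 ⊗ₜ 1) = w := by
  rw [E.mul_one_tmul, ← Algebra.TensorProduct.one_def, _root_.mul_one]

theorem tmul_one_mul_tmul (a b : A) (y : H) : E.mul (a ⊗ₜ 1) (b ⊗ₜ y) = (a * b) ⊗ₜ y := by
  simp [E.tmul_one_mul]

theorem tmul_mul_one_tmul (a : A) (x y : H) : E.mul (a ⊗ₜ x) (1 ⊗ₜ y) = a ⊗ₜ (x * y) := by
  simp [E.mul_one_tmul]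

theorem tmul_mul (a : A) (x : H) (w : A ⊗[k] H) :
    E.mul (a ⊗ₜ x) w = E.mul (a ⊗ₜ 1) (E.mul (1 ⊗ₜ x) w) := by
  rw [← E.mul_assoc, tmul_mul_one_tmul, _root_.one_mul]

theorem mul_tmul (w : A ⊗[k] H) (b : A) (y : H) :
    E.mul w (b ⊗ₜ y) = E.mul (E.mul w (b ⊗ₜ 1)) (1 ⊗ₜ y) := by
  rw [E.mul_assoc, tmul_mul_one_tmul, _root_.one_mul]

/-- The twist `x ⊗ a ↦ (1 ⊗ x) (a ⊗ 1)`. -/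
def twist : H ⊗[k] A →ₗ[k] A ⊗[k] H :=
  TensorProduct.lift (E.mul.compl₁₂ (TensorProduct.mk k A H 1) ((TensorProduct.mk k A H).flip 1))

@[simp] theorem twist_tmul (x : H) (a : A) :
    E.twist (x ⊗ₜ a) = E.mul (1 ⊗ₜ x) (a ⊗ₜ 1) := rfl

/-- The multiplication of E is compatible with Δ, and x ↦ 1 ⊗ x and a ↦ a ⊗ 1 are coalgebra maps
because 1 is grouplike. -/
theorem comul_twist (w : H ⊗[k] A) :
    comul (R := k) (E.twist w) = TensorProduct.map E.twist E.twist (comul w) := by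
  induction w with
  | zero => simp
  | add u v hu hv => simp only [map_add, hu, hv]
  | tmul x a =>
    have key : ∀ (q : H ⊗[k] H) (p : A ⊗[k] A), TensorProduct.map₂ E.mul E.mul
        (TensorProduct.map (TensorProduct.mk k A H 1) (TensorProduct.mk k A H 1) q)
        (TensorProduct.map ((TensorProduct.mk k A H).flip 1) ((TensorProduct.mk k A H).flip 1) p) =
        TensorProduct.map E.twist E.twist (tensorTensorTensorComm k H H A A (q ⊗ₜ p)) := by
      intro q p
      induction q with
      | zero => simp
      | add u v hu hv => simp only [add_tmul, map_add, LinearMap.add_apply, hu, hv]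
      | tmul x y =>
        induction p with
        | zero => simp
        | add u v hu hv => simp only [tmul_add, map_add, hu, hv]
        | tmul a b => simp
    rw [twist_tmul, E.comul_mul, comul_tmul_one, comul_one_tmul, key, TensorProduct.comul_tmul]
    rfl

theorem counit_twist (w : H ⊗[k] A) :
    counit (R := k) (E.twist w) = counit (R := k) w := by
  induction w with
  | zero => simp
  | add u v hu hv => simp only [map_add, hu, hv]
  | tmul x a => simp [E.counit_mul, mul_comm]

/-- The twist as a coalgebra map. -/
def twistCoalgHom : H ⊗[k] A →ₗc[k] A ⊗[k] H :=
  { E.twist with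
    counit_comp := LinearMap.ext E.counit_twist
    map_comp_comul := LinearMap.ext fun w => (E.comul_twist w).symm }

/-- The left action `x ▷ a = (id ⊗ ε) ((1 ⊗ x) (a ⊗ 1))`. -/
def lact : H ⊗[k] A →ₗc[k] A := (tensorFst k A H).comp E.twistCoalgHom

/-- The right action `x ◁ a = (ε ⊗ id) ((1 ⊗ x) (a ⊗ 1))`. -/
def ract : H ⊗[k] A →ₗc[k] H := (tensorSnd k A H).comp E.twistCoalgHom

theorem lact_tmul (x : H) (a : A) :
    E.lact (x ⊗ₜ a) = tensorFst k A H (E.mul (1 ⊗ₜ x) (a ⊗ₜ 1)) := rfl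

theorem ract_tmul (x : H) (a : A) :
    E.ract (x ⊗ₜ a) = tensorSnd k A H (E.mul (1 ⊗ₜ x) (a ⊗ₜ 1)) := rfl

/-- The twist is a coalgebra map, hence it is recovered from its components ▷ and ◁. This turns
every Sweedler expression in the matched pair axioms into a product in E. -/
theorem actTwist_lact_ract (w : H ⊗[k] A) :
    actTwist (E.lact : H ⊗[k] A →ₗ[k] A) (E.ract : H ⊗[k] A →ₗ[k] H) w = E.twist w := by
  rw [← map_tensorFst_tensorSnd_comul (E.twist w), comul_twist]
  simp only [actTwist, LinearMap.comp_apply]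
  generalize (comul w : (H ⊗[k] A) ⊗[k] (H ⊗[k] A)) = z
  induction z with
  | zero => simp
  | add u v hu hv => simp only [map_add, hu, hv]
  | tmul u v => rfl

theorem tensorFst_tmul_one_mul (a : A) (w : A ⊗[k] H) :
    tensorFst k A H (E.mul (a ⊗ₜ 1) w) = a * tensorFst k A H w := by
  induction w with
  | zero => simp
  | add u v hu hv => simp only [map_add, mul_add, hu, hv]
  | tmul b y => simp [tmul_one_mul_tmul]

theorem tensorSnd_tmul_one_mul (a : A) (w : A ⊗[k] H) :
    tensorSnd k A H (E.mul (a ⊗ₜ 1) w) = counit (R := k) a • tensorSnd k A H w := by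
  induction w with
  | zero => simp
  | add u v hu hv => simp only [map_add, smul_add, hu, hv]
  | tmul b y => simp [tmul_one_mul_tmul, mul_smul]

theorem tensorFst_mul_one_tmul (w : A ⊗[k] H) (y : H) :
    tensorFst k A H (E.mul w (1 ⊗ₜ y)) = counit (R := k) y • tensorFst k A H w := by
  induction w with
  | zero => simp
  | add u v hu hv => simp only [map_add, smul_add, LinearMap.add_apply, hu, hv]
  | tmul b y => simp [tmul_mul_one_tmul, mul_smul, mul_comm]

theorem tensorSnd_mul_one_tmul (w : A ⊗[k] H) (y : H) :
    tensorSnd k A H (E.mul w (1 ⊗ₜ y)) = tensorSnd k A H w * y := by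
  induction w with
  | zero => simp
  | add u v hu hv => simp only [map_add, add_mul, LinearMap.add_apply, hu, hv]
  | tmul b y => simp [tmul_mul_one_tmul]

/-- For w = a ⊗ x the product is a ((1 ⊗ x)(b ⊗ 1)), whose A-component is a (x ▷ b). With w a value
of the twist, this is the right side of the product rule for ▷; `tensorSnd_one_tmul_mul` plays that
role for ◁. -/
theorem tensorFst_mul_tmul_one (w : A ⊗[k] H) (b : A) :
    tensorFst k A H (E.mul w (b ⊗ₜ 1)) =
      LinearMap.mul' k A (((E.lact : H ⊗[k] A →ₗ[k] A) ∘ₗ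
        (TensorProduct.mk k H A).flip b).lTensor A w) := by
  induction w with
  | zero => simp
  | add u v hu hv => simp only [map_add, LinearMap.add_apply, hu, hv]
  | tmul a x => rw [tmul_mul, tensorFst_tmul_one_mul]; simp [lact_tmul]

theorem tensorSnd_mul_tmul_one (w : A ⊗[k] H) (b : A) :
    tensorSnd k A H (E.mul w (b ⊗ₜ 1)) = E.ract (tensorSnd k A H w ⊗ₜ b) := by
  induction w with
  | zero => simp
  | add u v hu hv => simp only [map_add, LinearMap.add_apply, add_tmul, hu, hv]
  | tmul a x => rw [tmul_mul, tensorSnd_tmul_one_mul]; simp [ract_tmul, ← smul_tmul']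

theorem tensorFst_one_tmul_mul (x : H) (w : A ⊗[k] H) :
    tensorFst k A H (E.mul (1 ⊗ₜ x) w) = E.lact (x ⊗ₜ tensorFst k A H w) := by
  induction w with
  | zero => simp
  | add u v hu hv => simp only [map_add, tmul_add, hu, hv]
  | tmul a y => rw [mul_tmul, tensorFst_mul_one_tmul]; simp [lact_tmul]

theorem tensorSnd_one_tmul_mul (x : H) (w : A ⊗[k] H) :
    tensorSnd k A H (E.mul (1 ⊗ₜ x) w) =
      LinearMap.mul' k H (((E.ract : H ⊗[k] A →ₗ[k] H) ∘ₗ TensorProduct.mk k H A x).rTensor H w) := by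
  induction w with
  | zero => simp
  | add u v hu hv => simp only [map_add, hu, hv]
  | tmul a y => rw [mul_tmul, tensorSnd_mul_one_tmul]; simp [ract_tmul]

/-- The matched pair of a bicrossed product of cocommutative Hopf algebras. -/
def matchedPair [IsCocomm k A] [IsCocomm k H] : HopfMatchedPair k A H where
  lact := E.lact
  ract := E.ract
  one_lact a := by simp [lact_tmul, E.one_mul]
  mul_lact x y a := by
    rw [lact_tmul, E.lact_tmul y, ← tensorFst_one_tmul_mul, ← E.mul_assoc, tmul_mul_one_tmul]
  ract_one x := by simp [ract_tmul, E.mul_one]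
  ract_mul x a b := by
    rw [ract_tmul, E.ract_tmul x a, ← tensorSnd_mul_tmul_one, E.mul_assoc, tmul_one_mul_tmul]
  lact_one x := by simp [lact_tmul, E.mul_one]
  one_ract a := by simp [ract_tmul, E.one_mul]
  -- The A-component of (x a) b = x (a b) in E; the next axiom is the H-component of x (y a) = (x y)
  -- a.
  lact_mul x a b := by
    rw [actTwist_lact_ract, ← tensorFst_mul_tmul_one, twist_tmul, E.mul_assoc, tmul_one_mul_tmul,
      lact_tmul]
  mul_ract x y a := by
    rw [actTwist_lact_ract, ← tensorSnd_one_tmul_mul, twist_tmul, ← E.mul_assoc,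
      tmul_mul_one_tmul, ract_tmul]
  -- Both sides differ by a flip of Δ(x ⊗ a), which is trivial as H ⊗ A is cocommutative.
  ract_lact_comm x a := by
    rw [actTwist, LinearMap.comp_apply, ← TensorProduct.map_comm, Coalgebra.comm_comul]

theorem bicrossedMul_matchedPair [IsCocomm k A] [IsCocomm k H] (a b : A) (x y : H) :
    E.matchedPair.bicrossedMul a x b y = E.mul (a ⊗ₜ x) (b ⊗ₜ y) := by
  have : ∀ w : A ⊗[k] H,
      TensorProduct.map (LinearMap.mulLeft k a) (LinearMap.mulRight k y) w =
        E.mul (a ⊗ₜ 1) (E.mul w (1 ⊗ₜ y)) := by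
    intro w
    induction w with
    | zero => simp
    | add u v hu hv => simp only [map_add, LinearMap.add_apply, hu, hv]
    | tmul b x => simp [tmul_mul_one_tmul, tmul_one_mul_tmul]
  rw [HopfMatchedPair.bicrossedMul, this, E.tmul_mul a x, E.mul_tmul (1 ⊗ₜ x) b y]
  exact congrArg (fun z => E.mul (a ⊗ₜ 1) (E.mul z (1 ⊗ₜ y))) (E.actTwist_lact_ract (x ⊗ₜ b))

/-! ### The two Hopf structures on the tensor product coalgebra -/

variable (k A H) in
/-- The product `(a ⊗ x) ∘ (b ⊗ y) = ab ⊗ yx`. -/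
def circMul : A ⊗[k] H →ₗ[k] A ⊗[k] H →ₗ[k] A ⊗[k] H :=
  TensorProduct.map₂ (LinearMap.mul k A) (LinearMap.mul k H).flip

@[simp] theorem circMul_tmul (a b : A) (x y : H) :
    circMul k A H (a ⊗ₜ x) (b ⊗ₜ y) = (a * b) ⊗ₜ (y * x) := rfl

/-- Left multiplication by A and right multiplication by H are the same in E as in A ⊗ H. This is
the link between ∘ and the bicrossed product. -/
theorem circMul_tmul_left (a : A) (x : H) (w : A ⊗[k] H) :
    circMul k A H (a ⊗ₜ x) w = E.mul (a ⊗ₜ 1) (E.mul w (1 ⊗ₜ x)) := by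
  induction w with
  | zero => simp
  | add u v hu hv => simp only [map_add, LinearMap.add_apply, hu, hv]
  | tmul b y => simp [tmul_mul_one_tmul, tmul_one_mul_tmul]

/-- The antipode `a ⊗ x ↦ (1 ⊗ S x) (S a ⊗ 1)`. -/
def antipode : A ⊗[k] H →ₗ[k] A ⊗[k] H :=
  TensorProduct.lift (E.mul.flip.compl₁₂
    ((TensorProduct.mk k A H).flip 1 ∘ₗ HopfAlgebra.antipode k (A := A))
    (TensorProduct.mk k A H 1 ∘ₗ HopfAlgebra.antipode k (A := H)))

@[simp] theorem antipode_tmul (a : A) (x : H) : E.antipode (a ⊗ₜ x) =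
    E.mul (1 ⊗ₜ HopfAlgebra.antipode k x) (HopfAlgebra.antipode k a ⊗ₜ 1) := rfl

/-- In S(x₁) S(a₁) a₂ x₂ the factors from A meet in the middle, so they collapse first. In the
mirrored lemma, a₁ x₁ S(x₂) S(a₂), those from H do. -/
theorem lift_mul_antipode_rTensor (p : A ⊗[k] A) (q : H ⊗[k] H) :
    TensorProduct.lift E.mul (E.antipode.rTensor _ (tensorTensorTensorComm k A A H H (p ⊗ₜ q))) =
      TensorProduct.lift E.mul (TensorProduct.map
        (TensorProduct.mk k A H 1 ∘ₗ HopfAlgebra.antipode k (A := H))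
        (TensorProduct.mk k A H (LinearMap.mul' k A ((HopfAlgebra.antipode k).rTensor A p))) q) := by
  induction p with
  | zero => simp [TensorProduct.map_zero_right]
  | add u v hu hv => simp only [add_tmul, map_add, hu, hv, TensorProduct.map_add_right,
      LinearMap.add_apply]
  | tmul a b =>
    induction q with
    | zero => simp
    | add u v hu hv => simp only [tmul_add, map_add, hu, hv]
    | tmul x y => simp [E.mul_assoc, tmul_one_mul_tmul]

theorem lift_mul_antipode_lTensor (p : A ⊗[k] A) (q : H ⊗[k] H) :
    TensorProduct.lift E.mul (E.antipode.lTensor _ (tensorTensorTensorComm k A A H H (p ⊗ₜ q))) =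
      TensorProduct.lift E.mul (TensorProduct.map
        ((TensorProduct.mk k A H).flip (LinearMap.mul' k H ((HopfAlgebra.antipode k).lTensor H q)))
        ((TensorProduct.mk k A H).flip 1 ∘ₗ HopfAlgebra.antipode k (A := A)) p) := by
  induction q with
  | zero => simp [TensorProduct.map_zero_left]
  | add u v hu hv => simp only [tmul_add, map_add, hu, hv, TensorProduct.map_add_left,
      LinearMap.add_apply]
  | tmul x y =>
    induction p with
    | zero => simp
    | add u v hu hv => simp only [add_tmul, map_add, hu, hv]
    | tmul a b => simp [← E.mul_assoc, tmul_mul_one_tmul]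

/-- The Hopf structure of the bicrossed product on the tensor product coalgebra. -/
def dot : HopfStructure k (A ⊗[k] H) where
  mul := E.mul
  one := 1 ⊗ₜ 1
  antipode := E.antipode
  mul_assoc := E.mul_assoc
  one_mul := E.one_mul
  mul_one := E.mul_one
  comul_mul := E.comul_mul
  comul_one := by simp [Algebra.TensorProduct.one_def]
  counit_mul := E.counit_mul
  counit_one := by simp
  antipode_mul w := by
    induction w with
    | zero => simp
    | add u v hu hv => simp only [map_add, hu, hv, add_smul]
    | tmul a x =>
      have key : ∀ (c : k) (q : H ⊗[k] H), TensorProduct.lift E.mul (TensorProduct.map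
          (TensorProduct.mk k A H 1 ∘ₗ HopfAlgebra.antipode k (A := H))
          (TensorProduct.mk k A H (algebraMap k A c)) q) =
          c • (1 ⊗ₜ LinearMap.mul' k H ((HopfAlgebra.antipode k).rTensor H q)) := by
        intro c q
        induction q with
        | zero => simp
        | add u v hu hv => simp only [tmul_add, map_add, smul_add, hu, hv]
        | tmul x y =>
          simp [Algebra.algebraMap_eq_smul_one, tmul_mul_one_tmul]
      rw [comul_tmul_eq, lift_mul_antipode_rTensor,
        HopfAlgebra.mul_antipode_rTensor_comul_apply, key,
        HopfAlgebra.mul_antipode_rTensor_comul_apply]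
      simp [Algebra.algebraMap_eq_smul_one, smul_smul, mul_comm]
  mul_antipode w := by
    induction w with
    | zero => simp
    | add u v hu hv => simp only [map_add, hu, hv, add_smul]
    | tmul a x =>
      have key : ∀ (c : k) (p : A ⊗[k] A), TensorProduct.lift E.mul (TensorProduct.map
          ((TensorProduct.mk k A H).flip (algebraMap k H c))
          ((TensorProduct.mk k A H).flip 1 ∘ₗ HopfAlgebra.antipode k (A := A)) p) =
          c • (LinearMap.mul' k A ((HopfAlgebra.antipode k).lTensor A p) ⊗ₜ 1) := by
        intro c p
        induction p with
        | zero => simp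
        | add u v hu hv => simp only [add_tmul, map_add, smul_add, hu, hv]
        | tmul a b =>
          simp [Algebra.algebraMap_eq_smul_one, tmul_one_mul_tmul]
      rw [comul_tmul_eq, lift_mul_antipode_lTensor,
        HopfAlgebra.mul_antipode_lTensor_comul_apply, key,
        HopfAlgebra.mul_antipode_lTensor_comul_apply]
      simp [Algebra.algebraMap_eq_smul_one, smul_smul, ← smul_tmul', mul_comm]

theorem comul_circMul (u v : A ⊗[k] H) :
    comul (R := k) (circMul k A H u v) =
      TensorProduct.map₂ (circMul k A H) (circMul k A H) (comul u) (comul v) := by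
  induction u with
  | zero => simp
  | add u v hu hv => simp only [map_add, LinearMap.add_apply, hu, hv]
  | tmul a x =>
    induction v with
    | zero => simp
    | add u v hu hv => simp only [map_add, hu, hv]
    | tmul b y =>
      have key : ∀ (p p' : A ⊗[k] A) (q q' : H ⊗[k] H),
          tensorTensorTensorComm k A A H H ((p * p') ⊗ₜ (q' * q)) =
          TensorProduct.map₂ (circMul k A H) (circMul k A H)
            (tensorTensorTensorComm k A A H H (p ⊗ₜ q))
            (tensorTensorTensorComm k A A H H (p' ⊗ₜ q')) := by
        intro p p' q q'
        induction p with
        | zero => simp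
        | add u v hu hv => simp only [add_mul, add_tmul, map_add, LinearMap.add_apply, hu, hv]
        | tmul a b =>
        induction p' with
        | zero => simp
        | add u v hu hv => simp only [mul_add, add_tmul, map_add, hu, hv]
        | tmul a' b' =>
        induction q with
        | zero => simp
        | add u v hu hv => simp only [mul_add, tmul_add, map_add, LinearMap.add_apply, hu, hv]
        | tmul x y =>
        induction q' with
        | zero => simp
        | add u v hu hv => simp only [add_mul, tmul_add, map_add, hu, hv]
        | tmul x' y' => simp
      rw [circMul_tmul, comul_tmul_eq, comul_tmul_eq, comul_tmul_eq, Bialgebra.comul_mul,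
        Bialgebra.comul_mul, key]

theorem counit_circMul (u v : A ⊗[k] H) :
    counit (R := k) (circMul k A H u v) = counit (R := k) u * counit (R := k) v := by
  induction u with
  | zero => simp
  | add u v hu hv => simp only [map_add, LinearMap.add_apply, add_mul, hu, hv]
  | tmul a x =>
    induction v with
    | zero => simp
    | add u v hu hv => simp only [map_add, mul_add, hu, hv]
    | tmul b y => simp only [circMul_tmul, TensorProduct.counit_tmul, Bialgebra.counit_mul,
        smul_eq_mul]; ring

theorem circMul_assoc (u v w : A ⊗[k] H) :
    circMul k A H (circMul k A H u v) w = circMul k A H u (circMul k A H v w) := by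
  induction u with
  | zero => simp
  | add u v hu hv => simp only [map_add, LinearMap.add_apply, hu, hv]
  | tmul a x =>
  induction v with
  | zero => simp
  | add u v hu hv => simp only [map_add, LinearMap.add_apply, hu, hv]
  | tmul b y =>
  induction w with
  | zero => simp
  | add u v hu hv => simp only [map_add, hu, hv]
  | tmul c z => simp [_root_.mul_assoc]

/-- The antipode law of the opposite product asks for x₂ S(x₁) = ε(x) 1, and cocommutativity turns
the left side into x₁ S(x₂). -/
theorem mul'_antipode_rTensor_comul_of_isCocomm [IsCocomm k H] (x : H) :
    LinearMap.mul' k H (TensorProduct.comm k H H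
      ((HopfAlgebra.antipode k).rTensor H (comul (R := k) x))) = algebraMap k H (counit x) := by
  rw [← HopfAlgebra.mul_antipode_lTensor_comul_apply, LinearMap.rTensor, ← TensorProduct.map_comm,
    Coalgebra.comm_comul]
  rfl

theorem mul'_antipode_lTensor_comul_of_isCocomm [IsCocomm k H] (x : H) :
    LinearMap.mul' k H (TensorProduct.comm k H H
      ((HopfAlgebra.antipode k).lTensor H (comul (R := k) x))) = algebraMap k H (counit x) := by
  rw [← HopfAlgebra.mul_antipode_rTensor_comul_apply, LinearMap.lTensor, ← TensorProduct.map_comm,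
    Coalgebra.comm_comul]
  rfl

variable (k A H) in
/-- The Hopf structure `A ⊗ H^op` on the tensor product coalgebra. -/
def circ [IsCocomm k H] : HopfStructure k (A ⊗[k] H) where
  mul := circMul k A H
  one := 1 ⊗ₜ 1
  antipode := TensorProduct.map (HopfAlgebra.antipode k) (HopfAlgebra.antipode k)
  mul_assoc := circMul_assoc
  one_mul w := by
    induction w with
    | zero => simp
    | add u v hu hv => simp only [map_add, hu, hv]
    | tmul a x => simp
  mul_one w := by
    induction w with
    | zero => simp
    | add u v hu hv => simp only [map_add, LinearMap.add_apply, hu, hv]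
    | tmul a x => simp
  comul_mul := comul_circMul
  comul_one := by simp [Algebra.TensorProduct.one_def]
  counit_mul := counit_circMul
  counit_one := by simp
  antipode_mul w := by
    induction w with
    | zero => simp
    | add u v hu hv => simp only [map_add, hu, hv, add_smul]
    | tmul a x =>
      have key : ∀ (p : A ⊗[k] A) (q : H ⊗[k] H), TensorProduct.lift (circMul k A H)
          ((TensorProduct.map (HopfAlgebra.antipode k) (HopfAlgebra.antipode k)).rTensor (A ⊗[k] H)
            (tensorTensorTensorComm k A A H H (p ⊗ₜ q))) =
          LinearMap.mul' k A ((HopfAlgebra.antipode k).rTensor A p) ⊗ₜ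
            LinearMap.mul' k H (TensorProduct.comm k H H
              ((HopfAlgebra.antipode k).rTensor H q)) := by
        intro p q
        induction p with
        | zero => simp
        | add u v hu hv => simp only [add_tmul, map_add, hu, hv]
        | tmul a b =>
        induction q with
        | zero => simp
        | add u v hu hv => simp only [tmul_add, map_add, hu, hv]
        | tmul x y => simp
      rw [comul_tmul_eq, key, HopfAlgebra.mul_antipode_rTensor_comul_apply,
        mul'_antipode_rTensor_comul_of_isCocomm]
      simp [Algebra.algebraMap_eq_smul_one, ← smul_tmul', smul_smul, mul_comm]
  mul_antipode w := by
    induction w with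
    | zero => simp
    | add u v hu hv => simp only [map_add, hu, hv, add_smul]
    | tmul a x =>
      have key : ∀ (p : A ⊗[k] A) (q : H ⊗[k] H), TensorProduct.lift (circMul k A H)
          ((TensorProduct.map (HopfAlgebra.antipode k) (HopfAlgebra.antipode k)).lTensor (A ⊗[k] H)
            (tensorTensorTensorComm k A A H H (p ⊗ₜ q))) =
          LinearMap.mul' k A ((HopfAlgebra.antipode k).lTensor A p) ⊗ₜ
            LinearMap.mul' k H (TensorProduct.comm k H H
              ((HopfAlgebra.antipode k).lTensor H q)) := by
        intro p q
        induction p with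
        | zero => simp
        | add u v hu hv => simp only [add_tmul, map_add, hu, hv]
        | tmul a b =>
        induction q with
        | zero => simp
        | add u v hu hv => simp only [tmul_add, map_add, hu, hv]
        | tmul x y => simp
      rw [comul_tmul_eq, key, HopfAlgebra.mul_antipode_lTensor_comul_apply,
        mul'_antipode_lTensor_comul_of_isCocomm]
      simp [Algebra.algebraMap_eq_smul_one, ← smul_tmul', smul_smul, mul_comm]

/-! ### The Hopf brace identity -/

/-- The map `x ↦ (1 ⊗ S x₁) w (1 ⊗ x₂)`. -/
def conjRight (w : A ⊗[k] H) : H →ₗ[k] A ⊗[k] H :=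
  TensorProduct.lift E.mul ∘ₗ TensorProduct.map
    (TensorProduct.mk k A H 1 ∘ₗ HopfAlgebra.antipode k (A := H))
    (E.mul w ∘ₗ TensorProduct.mk k A H 1) ∘ₗ comul

/-- This is x₁ S(x₂) w x₃ = w x: coassociativity brings x₁ and S(x₂) together, and the antipode and
counit laws remove them. -/
theorem lift_mul_conjRight (w : A ⊗[k] H) (x : H) :
    TensorProduct.lift E.mul (TensorProduct.map (TensorProduct.mk k A H 1) (E.conjRight w)
      (comul x)) = E.mul w (1 ⊗ₜ x) := by
  have h1 : ∀ r : (H ⊗[k] H) ⊗[k] H, TensorProduct.lift E.mul (TensorProduct.map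
      (TensorProduct.mk k A H 1) (TensorProduct.lift E.mul ∘ₗ TensorProduct.map
        (TensorProduct.mk k A H 1 ∘ₗ HopfAlgebra.antipode k (A := H))
        (E.mul w ∘ₗ TensorProduct.mk k A H 1)) (TensorProduct.assoc k H H H r)) =
      TensorProduct.lift E.mul (TensorProduct.map (TensorProduct.mk k A H 1 ∘ₗ
        LinearMap.mul' k H ∘ₗ (HopfAlgebra.antipode k).lTensor H)
        (E.mul w ∘ₗ TensorProduct.mk k A H 1) r) := by
    intro r
    induction r with
    | zero => simp
    | add u v hu hv => simp only [map_add, hu, hv]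
    | tmul s z =>
      induction s with
      | zero => simp
      | add u v hu hv => simp only [add_tmul, map_add, hu, hv]
      | tmul x y => simp [← E.mul_assoc, tmul_mul_one_tmul]
  have h2 : ∀ q : H ⊗[k] H, TensorProduct.map (TensorProduct.mk k A H 1) (E.conjRight w) q =
      TensorProduct.map (TensorProduct.mk k A H 1) (TensorProduct.lift E.mul ∘ₗ TensorProduct.map
        (TensorProduct.mk k A H 1 ∘ₗ HopfAlgebra.antipode k (A := H))
        (E.mul w ∘ₗ TensorProduct.mk k A H 1)) (comul.lTensor H q) := by
    intro q
    induction q with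
    | zero => simp
    | add u v hu hv => simp only [map_add, hu, hv]
    | tmul x y => simp [conjRight]
  have h3 : ∀ q : H ⊗[k] H, TensorProduct.lift E.mul (TensorProduct.map
      (TensorProduct.mk k A H 1 ∘ₗ LinearMap.mul' k H ∘ₗ (HopfAlgebra.antipode k).lTensor H)
        (E.mul w ∘ₗ TensorProduct.mk k A H 1) (comul.rTensor H q)) =
      E.mul w (1 ⊗ₜ TensorProduct.lid k H (counit.rTensor H q)) := by
    intro q
    induction q with
    | zero => simp
    | add u v hu hv => simp only [map_add, tmul_add, hu, hv]
    | tmul x y =>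
      simp [HopfAlgebra.mul_antipode_lTensor_comul_apply, Algebra.algebraMap_eq_smul_one, E.one_mul]
  rw [h2, ← Coalgebra.coassoc_apply, h1, h3, Coalgebra.rTensor_counit_comul]
  simp

/-- For v = a ⊗ x, S(v₁)(v₂ ∘ w) is S(x₁) S(a₁) a₂ w x₂, and the factors from A cancel to ε(a). -/
theorem lift_mul_antipode_circMul (w v : A ⊗[k] H) :
    TensorProduct.lift E.mul (TensorProduct.map E.antipode ((circMul k A H).flip w) (comul v)) =
      E.conjRight w (tensorSnd k A H v) := by
  induction v with
  | zero => simp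
  | add u v hu hv => simp only [map_add, hu, hv]
  | tmul a x =>
    have key : ∀ (p : A ⊗[k] A) (q : H ⊗[k] H), TensorProduct.lift E.mul
        (TensorProduct.map E.antipode ((circMul k A H).flip w)
          (tensorTensorTensorComm k A A H H (p ⊗ₜ q))) =
        TensorProduct.lift E.mul (TensorProduct.map
          (TensorProduct.mk k A H 1 ∘ₗ HopfAlgebra.antipode k (A := H))
          (E.mul (E.mul (LinearMap.mul' k A ((HopfAlgebra.antipode k).rTensor A p) ⊗ₜ 1) w) ∘ₗ
            TensorProduct.mk k A H 1) q) := by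
      intro p q
      induction q with
      | zero => simp
      | add u v hu hv => simp only [tmul_add, map_add, hu, hv]
      | tmul x y =>
        induction p with
        | zero => simp
        | add u v hu hv =>
          simp only [add_tmul, map_add, hu, hv, TensorProduct.map_tmul, LinearMap.comp_apply,
            LinearMap.add_apply, tmul_add]
        | tmul a b =>
          simp only [tensorTensorTensorComm_tmul, TensorProduct.map_tmul, antipode_tmul,
            LinearMap.flip_apply, E.circMul_tmul_left, TensorProduct.lift.tmul, LinearMap.comp_apply,
            TensorProduct.mk_apply, LinearMap.rTensor_tmul, LinearMap.mul'_apply, E.mul_assoc]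
          rw [← tmul_one_mul_tmul E _ b, E.mul_assoc]
    rw [comul_tmul_eq, key, HopfAlgebra.mul_antipode_rTensor_comul_apply, tensorSnd_tmul,
      Algebra.algebraMap_eq_smul_one, ← smul_tmul', map_smul, LinearMap.smul_apply, E.one_mul,
      map_smul, LinearMap.smul_comp, TensorProduct.map_smul_right, LinearMap.smul_apply, map_smul,
      map_smul]
    rfl

theorem circMul_mul (u v w : A ⊗[k] H) : circMul k A H u (E.mul v w) =
    TensorProduct.lift E.mul (TensorProduct.map ((circMul k A H).flip v)
      (TensorProduct.lift E.mul ∘ₗ TensorProduct.map E.antipode ((circMul k A H).flip w))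
        ((comul (R := k)).lTensor (A ⊗[k] H) (comul u))) := by
  -- The last two legs of Δ²(u) depend only on the H-component of their common leg, so only a single
  -- Δ remains to be expanded on a ⊗ x.
  have h : (TensorProduct.lift E.mul ∘ₗ TensorProduct.map E.antipode ((circMul k A H).flip w)) ∘ₗ
      comul = E.conjRight w ∘ₗ (tensorSnd k A H : A ⊗[k] H →ₗ[k] H) :=
    LinearMap.ext (E.lift_mul_antipode_circMul w)
  rw [← LinearMap.comp_apply (TensorProduct.map _ _), LinearMap.map_comp_lTensor, h]
  induction u with
  | zero => simp
  | add u v hu hv => simp only [map_add, LinearMap.add_apply, hu, hv]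
  | tmul a x =>
    have key : ∀ (p : A ⊗[k] A) (q : H ⊗[k] H), TensorProduct.lift E.mul
        (TensorProduct.map ((circMul k A H).flip v)
          (E.conjRight w ∘ₗ (tensorSnd k A H : A ⊗[k] H →ₗ[k] H))
          (tensorTensorTensorComm k A A H H (p ⊗ₜ q))) =
        E.mul (TensorProduct.rid k A (counit.lTensor A p) ⊗ₜ 1) (E.mul v (TensorProduct.lift E.mul
          (TensorProduct.map (TensorProduct.mk k A H 1) (E.conjRight w) q))) := by
      intro p q
      induction p with
      | zero => simp
      | add u v hu hv => simp only [add_tmul, map_add, LinearMap.add_apply, hu, hv]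
      | tmul a b =>
        induction q with
        | zero => simp
        | add u v hu hv => simp only [tmul_add, map_add, hu, hv]
        | tmul x y => simp [E.circMul_tmul_left, E.mul_assoc, ← smul_tmul']
    rw [comul_tmul_eq, key, lift_mul_conjRight, Coalgebra.lTensor_counit_comul, circMul_tmul_left,
      E.mul_assoc]
    simp

/-- The Hopf brace of a bicrossed product. -/
def hopfBrace [IsCocomm k H] : HopfBrace k (A ⊗[k] H) where
  dot := E.dot
  circ := circ k A H
  circ_dot := E.circMul_mul

theorem exists_hopfBrace [IsCocomm k A] [IsCocomm k H] :
    ∃ B : HopfBrace k (A ⊗[k] H), B.IsCocommutative ∧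
      (∀ (a b : A) (x y : H), B.dot.mul (a ⊗ₜ x) (b ⊗ₜ y) = E.matchedPair.bicrossedMul a x b y) ∧
      (∀ (a b : A) (x y : H), B.circ.mul (a ⊗ₜ x) (b ⊗ₜ y) = (a * b) ⊗ₜ (y * x)) :=
  ⟨E.hopfBrace, inferInstanceAs (IsCocomm k (A ⊗[k] H)),
    fun a b x y => (E.bicrossedMul_matchedPair a b x y).symm, fun _ _ _ _ => rfl⟩

end BicrossedProduct

/-! ### Matched pairs of groups -/

namespace GroupMatchedPair

variable {G H : Type*} [Group G] [Group H] (k : Type*) [Field k]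

variable (G H) in
/-- The basis `g ⊗ h` of `k[G] ⊗ k[H]`. -/
def tensorBasis : Module.Basis (G × H) k (MonoidAlgebra k G ⊗[k] MonoidAlgebra k H) :=
  (Module.Basis.ofRepr (MonoidAlgebra.coeffLinearEquiv k)).tensorProduct
    (Module.Basis.ofRepr (MonoidAlgebra.coeffLinearEquiv k))

theorem tensorBasis_apply (p : G × H) : tensorBasis G H k p =
    MonoidAlgebra.of k G p.1 ⊗ₜ MonoidAlgebra.of k H p.2 := by
  rw [tensorBasis, Module.Basis.tensorProduct_apply']
  rfl

variable {k} in
theorem tensor_induction {p : MonoidAlgebra k G ⊗[k] MonoidAlgebra k H → Prop}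
    (zero : p 0) (add : ∀ u v, p u → p v → p (u + v)) (smul : ∀ (c : k) u, p u → p (c • u))
    (of : ∀ g h, p (MonoidAlgebra.of k G g ⊗ₜ MonoidAlgebra.of k H h))
    (w : MonoidAlgebra k G ⊗[k] MonoidAlgebra k H) : p w := by
  have hw : w ∈ Submodule.span k (Set.range (tensorBasis G H k)) := by
    rw [Module.Basis.span_eq]; trivial
  induction hw using Submodule.span_induction with
  | mem x hx =>
    obtain ⟨q, rfl⟩ := hx
    rw [tensorBasis_apply]
    exact of _ _
  | zero => exact zero
  | add u v _ _ hu hv => exact add u v hu hv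
  | smul c u _ hu => exact smul c u hu

theorem comul_of (g : G) : comul (R := k) (MonoidAlgebra.of k G g) =
    MonoidAlgebra.of k G g ⊗ₜ MonoidAlgebra.of k G g := by
  simp [MonoidAlgebra.of_apply]

theorem counit_of (g : G) : counit (R := k) (MonoidAlgebra.of k G g) = 1 := by
  simp [MonoidAlgebra.of_apply]

variable (M : GroupMatchedPair G H)

/-- The multiplication of the Zappa–Szép product, extended linearly. -/
def mulMap : MonoidAlgebra k G ⊗[k] MonoidAlgebra k H →ₗ[k]
    MonoidAlgebra k G ⊗[k] MonoidAlgebra k H →ₗ[k] MonoidAlgebra k G ⊗[k] MonoidAlgebra k H :=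
  (tensorBasis G H k).constr k fun p => (tensorBasis G H k).constr k fun q =>
    MonoidAlgebra.of k G (p.1 * M.lact p.2 q.1) ⊗ₜ MonoidAlgebra.of k H (M.ract p.2 q.1 * q.2)

theorem mulMap_of (g g' : G) (h h' : H) :
    M.mulMap k (MonoidAlgebra.of k G g ⊗ₜ MonoidAlgebra.of k H h)
      (MonoidAlgebra.of k G g' ⊗ₜ MonoidAlgebra.of k H h') =
    MonoidAlgebra.of k G (g * M.lact h g') ⊗ₜ MonoidAlgebra.of k H (M.ract h g' * h') := by
  have e := tensorBasis_apply (G := G) (H := H) k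
  rw [← e (g, h), ← e (g', h'), mulMap, Module.Basis.constr_basis, Module.Basis.constr_basis]

theorem mulMap_assoc (u v w : MonoidAlgebra k G ⊗[k] MonoidAlgebra k H) :
    M.mulMap k (M.mulMap k u v) w = M.mulMap k u (M.mulMap k v w) := by
  induction u using tensor_induction with
  | zero => simp
  | add u v hu hv => simp only [map_add, LinearMap.add_apply, hu, hv]
  | smul c u hu => simp only [map_smul, LinearMap.smul_apply, hu]
  | of g h =>
  induction v using tensor_induction with
  | zero => simp
  | add u v hu hv => simp only [map_add, LinearMap.add_apply, hu, hv]
  | smul c u hu => simp only [map_smul, LinearMap.smul_apply, hu]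
  | of g' h' =>
  induction w using tensor_induction with
  | zero => simp
  | add u v hu hv => simp only [map_add, hu, hv]
  | smul c u hu => simp only [map_smul, hu]
  -- On basis elements this is associativity of the Zappa–Szép product.
  | of g'' h'' => simp only [mulMap_of, M.lact_mul, M.mul_ract, M.ract_mul, M.mul_lact, mul_assoc]

/-- The basis elements g ⊗ h are grouplike and their products are again basis elements. -/
theorem comul_mulMap (u v : MonoidAlgebra k G ⊗[k] MonoidAlgebra k H) :
    comul (R := k) (M.mulMap k u v) =
      TensorProduct.map₂ (M.mulMap k) (M.mulMap k) (comul u) (comul v) := by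
  induction u using tensor_induction with
  | zero => simp
  | add u v hu hv => simp only [map_add, LinearMap.add_apply, hu, hv]
  | smul c u hu => simp only [map_smul, LinearMap.smul_apply, hu]
  | of g h =>
  induction v using tensor_induction with
  | zero => simp
  | add u v hu hv => simp only [map_add, hu, hv]
  | smul c u hu => simp only [map_smul, hu]
  | of g' h' =>
    simp only [mulMap_of, comul_tmul_eq, comul_of, tensorTensorTensorComm_tmul,
      TensorProduct.map₂_apply_tmul, TensorProduct.map_tmul]

theorem counit_mulMap (u v : MonoidAlgebra k G ⊗[k] MonoidAlgebra k H) :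
    counit (R := k) (M.mulMap k u v) = counit (R := k) u * counit (R := k) v := by
  induction u using tensor_induction with
  | zero => simp
  | add u v hu hv => simp only [map_add, LinearMap.add_apply, add_mul, hu, hv]
  | smul c u hu => simp only [map_smul, LinearMap.smul_apply, smul_mul_assoc, hu]
  | of g h =>
  induction v using tensor_induction with
  | zero => simp
  | add u v hu hv => simp only [map_add, mul_add, hu, hv]
  | smul c u hu => simp only [map_smul, mul_smul_comm, hu]
  | of g' h' =>
    simp only [mulMap_of, TensorProduct.counit_tmul, counit_of, smul_eq_mul, _root_.mul_one]

theorem mulMap_tmul_one (a : MonoidAlgebra k G) (w : MonoidAlgebra k G ⊗[k] MonoidAlgebra k H) :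
    M.mulMap k (a ⊗ₜ 1) w = (a ⊗ₜ 1) * w := by
  induction w using tensor_induction with
  | zero => simp
  | add u v hu hv => simp only [map_add, mul_add, hu, hv]
  | smul c u hu => simp only [map_smul, mul_smul_comm, hu]
  | of g h =>
  induction a using MonoidAlgebra.induction_on with
  | of g' =>
    rw [← map_one (MonoidAlgebra.of k H), mulMap_of, M.one_lact, M.one_ract,
      Algebra.TensorProduct.tmul_mul_tmul, ← map_mul, ← map_mul]
  | add u v hu hv => simp only [add_tmul, map_add, LinearMap.add_apply, add_mul, hu, hv]
  | smul c u hu =>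
    simp only [← smul_tmul', map_smul, LinearMap.smul_apply, smul_mul_assoc, hu]

theorem mulMap_one_tmul (w : MonoidAlgebra k G ⊗[k] MonoidAlgebra k H) (y : MonoidAlgebra k H) :
    M.mulMap k w (1 ⊗ₜ y) = w * (1 ⊗ₜ y) := by
  induction w using tensor_induction with
  | zero => simp
  | add u v hu hv => simp only [map_add, add_mul, LinearMap.add_apply, hu, hv]
  | smul c u hu => simp only [map_smul, smul_mul_assoc, LinearMap.smul_apply, hu]
  | of g h =>
  induction y using MonoidAlgebra.induction_on with
  | of h' =>
    rw [← map_one (MonoidAlgebra.of k G), mulMap_of, M.lact_one, M.ract_one,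
      Algebra.TensorProduct.tmul_mul_tmul, ← map_mul, ← map_mul]
  | add u v hu hv => simp only [tmul_add, map_add, mul_add, hu, hv]
  | smul c u hu => simp only [tmul_smul, map_smul, mul_smul_comm, hu]

/-- The bicrossed product of group algebras. -/
def bicrossedProduct : BicrossedProduct k (MonoidAlgebra k G) (MonoidAlgebra k H) where
  mul := M.mulMap k
  mul_assoc := M.mulMap_assoc k
  tmul_one_mul := M.mulMap_tmul_one k
  mul_one_tmul := M.mulMap_one_tmul k
  comul_mul := M.comul_mulMap k
  counit_mul := M.counit_mulMap k

theorem bicrossedProduct_mul_of (g : G) (h : H) :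
    (M.bicrossedProduct k).mul (1 ⊗ₜ MonoidAlgebra.of k H h) (MonoidAlgebra.of k G g ⊗ₜ 1) =
      MonoidAlgebra.of k G (M.lact h g) ⊗ₜ MonoidAlgebra.of k H (M.ract h g) := by
  have := M.mulMap_of k 1 g h 1
  rwa [map_one, map_one, _root_.one_mul, _root_.mul_one] at this

theorem bicrossedProduct_lact_of (g : G) (h : H) :
    (M.bicrossedProduct k).lact (MonoidAlgebra.of k H h ⊗ₜ MonoidAlgebra.of k G g) =
      MonoidAlgebra.of k G (M.lact h g) := by
  rw [BicrossedProduct.lact_tmul, bicrossedProduct_mul_of, tensorFst_tmul, counit_of, one_smul]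

theorem bicrossedProduct_ract_of (g : G) (h : H) :
    (M.bicrossedProduct k).ract (MonoidAlgebra.of k H h ⊗ₜ MonoidAlgebra.of k G g) =
      MonoidAlgebra.of k H (M.ract h g) := by
  rw [BicrossedProduct.ract_tmul, bicrossedProduct_mul_of, tensorSnd_tmul, counit_of, one_smul]

variable {k} in
theorem coalgHom_ext {C : Type*} [AddCommMonoid C] [Module k C] [Coalgebra k C]
    {f f' : MonoidAlgebra k H ⊗[k] MonoidAlgebra k G →ₗc[k] C}
    (hf : ∀ h g, f (MonoidAlgebra.of k H h ⊗ₜ MonoidAlgebra.of k G g) =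
      f' (MonoidAlgebra.of k H h ⊗ₜ MonoidAlgebra.of k G g)) : f = f' := by
  ext w
  induction w using tensor_induction with
  | zero => simp
  | add u v hu hv => simp only [map_add, hu, hv]
  | smul c u hu => simp only [map_smul, hu]
  | of h g => exact hf h g

end GroupMatchedPair

/-! ### Induction principles and cocommutativity for enveloping algebras -/

namespace UniversalEnvelopingAlgebra

attribute [local instance] LieRing.ofAssociativeRing

variable {R L : Type*} [CommRing R] [LieRing L] [LieAlgebra R L]

theorem comul_ι (x : L) : comul (R := R) (ι R x) = ι R x ⊗ₜ 1 + 1 ⊗ₜ ι R x :=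
  comulHom_ι R L x

theorem counit_ι (x : L) : counit (R := R) (ι R x) = 0 :=
  counitHom_ι R L x

theorem ι_lie (x y : L) : ι R ⁅x, y⁆ = ι R x * ι R y - ι R y * ι R x := by
  rw [LieHom.map_lie, LieRing.of_associative_ring_bracket]

/-- Induction on left multiplication by elements of `L`. -/
theorem left_induction {p : UniversalEnvelopingAlgebra R L → Prop}
    (one : p 1) (smul : ∀ (r : R) u, p u → p (r • u)) (add : ∀ u v, p u → p v → p (u + v))
    (ι_mul : ∀ x u, p u → p (ι R x * u)) (u : UniversalEnvelopingAlgebra R L) : p u := by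
  -- Stability of p under left multiplication by u is itself stable under products in u, unlike p
  -- alone.
  have key : ∀ u v : UniversalEnvelopingAlgebra R L, p v → p (u * v) := by
    intro u
    induction u using induction_ι R L with
    | hr r => intro v hv; rw [← Algebra.smul_def]; exact smul r v hv
    | hι x => exact ι_mul x
    | hadd a b ha hb => intro v hv; rw [add_mul]; exact add _ _ (ha v hv) (hb v hv)
    | hmul a b ha hb => intro v hv; rw [mul_assoc]; exact ha _ (hb v hv)
  simpa using key u 1 one

/-- Induction on right multiplication by elements of `L`. -/
theorem right_induction {p : UniversalEnvelopingAlgebra R L → Prop}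
    (one : p 1) (smul : ∀ (r : R) u, p u → p (r • u)) (add : ∀ u v, p u → p v → p (u + v))
    (mul_ι : ∀ u x, p u → p (u * ι R x)) (u : UniversalEnvelopingAlgebra R L) : p u := by
  have key : ∀ u v : UniversalEnvelopingAlgebra R L, p v → p (v * u) := by
    intro u
    induction u using induction_ι R L with
    | hr r => intro v hv; rw [← Algebra.commutes, ← Algebra.smul_def]; exact smul r v hv
    | hι x => exact fun v hv => mul_ι v x hv
    | hadd a b ha hb => intro v hv; rw [mul_add]; exact add _ _ (ha v hv) (hb v hv)
    | hmul a b ha hb => intro v hv; rw [← mul_assoc]; exact hb _ (ha v hv)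
  simpa using key u 1 one

/-- Δ and its flip are algebra maps, and they agree on L because x ⊗ 1 + 1 ⊗ x is symmetric. -/
instance instIsCocomm : IsCocomm R (UniversalEnvelopingAlgebra R L) where
  comm_comp_comul := by
    have : (Algebra.TensorProduct.comm R (UniversalEnvelopingAlgebra R L)
        (UniversalEnvelopingAlgebra R L)).toAlgHom.comp (comulHom R L) = comulHom R L := by
      ext x
      simp [-ι_apply, add_comm]
    exact LinearMap.ext fun u => DFunLike.congr_fun this u

end UniversalEnvelopingAlgebra

/-! ### Matched pairs of Lie algebras: the action of 𝔥 on U(𝔤) ⊗ U(𝔥) -/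

namespace LieMatchedPair

open UniversalEnvelopingAlgebra

attribute [local instance] LieRing.ofAssociativeRing

variable {k 𝔤 𝔥 : Type*} [Field k] [LieRing 𝔤] [LieAlgebra k 𝔤] [LieRing 𝔥] [LieAlgebra k 𝔥]

variable (k 𝔤 𝔥) in
/-- The inclusion of `𝔤` into `U(𝔤) ⊗ U(𝔥)`. -/
def inl : 𝔤 →ₗ[k] UniversalEnvelopingAlgebra k 𝔤 ⊗[k] UniversalEnvelopingAlgebra k 𝔥 :=
  (TensorProduct.mk k _ (UniversalEnvelopingAlgebra k 𝔥)).flip 1 ∘ₗ (ι k : 𝔤 →ₗ⁅k⁆ _).toLinearMap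

theorem inl_apply (a : 𝔤) : inl k 𝔤 𝔥 a = ι k a ⊗ₜ 1 := rfl

theorem inl_lie (a b : 𝔤) : inl k 𝔤 𝔥 ⁅a, b⁆ =
    inl k 𝔤 𝔥 a * inl k 𝔤 𝔥 b - inl k 𝔤 𝔥 b * inl k 𝔤 𝔥 a := by
  simp only [inl_apply, ι_lie, sub_tmul, Algebra.TensorProduct.tmul_mul_tmul, mul_one]

/-- The space is generated from 1 ⊗ U(𝔥) by left multiplication by 𝔤. Scalars need no case of their
own, since they move into the factor U(𝔥). -/
theorem tensor_induction
    {p : UniversalEnvelopingAlgebra k 𝔤 ⊗[k] UniversalEnvelopingAlgebra k 𝔥 → Prop}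
    (add : ∀ u v, p u → p v → p (u + v))
    (one_tmul : ∀ y, p (1 ⊗ₜ y)) (inl_mul : ∀ a w, p w → p (inl k 𝔤 𝔥 a * w))
    (w : UniversalEnvelopingAlgebra k 𝔤 ⊗[k] UniversalEnvelopingAlgebra k 𝔥) : p w := by
  induction w with
  | zero => simpa using one_tmul 0
  | add u v hu hv => exact add u v hu hv
  | tmul u y =>
    induction u using left_induction generalizing y with
    | one => exact one_tmul y
    | smul r u hu => rw [smul_tmul]; exact hu _
    | add u v hu hv => rw [add_tmul]; exact add _ _ (hu y) (hv y)
    | ι_mul a u hu =>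
      have := inl_mul a _ (hu y)
      rwa [inl_apply, Algebra.TensorProduct.tmul_mul_tmul, one_mul] at this

variable (M : LieMatchedPair k 𝔤 𝔥)

/-- The action of `𝔤` on `W × Hom(𝔥, W)`, for `W = U(𝔤) ⊗ U(𝔥)`, given by
`a (w, f) = (a w, x ↦ (x ▷ a) w + a f(x) + f(x ◁ a))`. -/
def prodAction (a : 𝔤) : Module.End k
    ((UniversalEnvelopingAlgebra k 𝔤 ⊗[k] UniversalEnvelopingAlgebra k 𝔥) ×
      (𝔥 →ₗ[k] UniversalEnvelopingAlgebra k 𝔤 ⊗[k] UniversalEnvelopingAlgebra k 𝔥)) where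
  toFun p := (inl k 𝔤 𝔥 a * p.1,
    { toFun := fun x => inl k 𝔤 𝔥 (M.lact x a) * p.1 + inl k 𝔤 𝔥 a * p.2 x + p.2 (M.ract x a)
      map_add' := fun x y => by
        simp only [map_add, LinearMap.add_apply, add_mul, mul_add]; abel
      map_smul' := fun r x => by
        simp only [map_smul, LinearMap.smul_apply, smul_mul_assoc, mul_smul_comm, smul_add,
          RingHom.id_apply] })
  map_add' p q := by
    refine Prod.ext (mul_add _ _ _) (LinearMap.ext fun x => ?_)
    simp only [Prod.fst_add, Prod.snd_add, LinearMap.add_apply, mul_add, LinearMap.coe_mk,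
      AddHom.coe_mk]
    abel
  map_smul' r p := by
    refine Prod.ext (mul_smul_comm _ _ _) (LinearMap.ext fun x => ?_)
    simp only [Prod.smul_fst, Prod.smul_snd, LinearMap.smul_apply, mul_smul_comm, LinearMap.coe_mk,
      AddHom.coe_mk, smul_add, RingHom.id_apply]

theorem prodAction_fst (a : 𝔤) (p) : (M.prodAction a p).1 = inl k 𝔤 𝔥 a * p.1 := rfl

theorem prodAction_snd (a : 𝔤) (p) (x : 𝔥) : (M.prodAction a p).2 x =
    inl k 𝔤 𝔥 (M.lact x a) * p.1 + inl k 𝔤 𝔥 a * p.2 x + p.2 (M.ract x a) := rfl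

/-- `prodAction` as a homomorphism of Lie algebras. -/
def prodActionHom : 𝔤 →ₗ⁅k⁆ Module.End k
    ((UniversalEnvelopingAlgebra k 𝔤 ⊗[k] UniversalEnvelopingAlgebra k 𝔥) ×
      (𝔥 →ₗ[k] UniversalEnvelopingAlgebra k 𝔤 ⊗[k] UniversalEnvelopingAlgebra k 𝔥)) where
  toFun := M.prodAction
  map_add' a b := by
    refine LinearMap.ext fun p => Prod.ext ?_ (LinearMap.ext fun x => ?_)
    · simp only [LinearMap.add_apply, Prod.fst_add, prodAction_fst, map_add, add_mul]
    · simp only [LinearMap.add_apply, Prod.snd_add, prodAction_snd, map_add, add_mul]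
      abel
  map_smul' r a := by
    refine LinearMap.ext fun p => Prod.ext ?_ (LinearMap.ext fun x => ?_)
    · simp only [LinearMap.smul_apply, Prod.smul_fst, prodAction_fst, map_smul, smul_mul_assoc,
        RingHom.id_apply]
    · simp only [LinearMap.smul_apply, Prod.smul_snd, prodAction_snd, map_smul, smul_mul_assoc,
        RingHom.id_apply, smul_add]
  map_lie' {a b} := by
    refine LinearMap.ext fun p => Prod.ext ?_ (LinearMap.ext fun x => ?_)
    · simp only [LieRing.of_associative_ring_bracket, LinearMap.sub_apply, Module.End.mul_apply,
        Prod.fst_sub, prodAction_fst, inl_lie, sub_mul, mul_assoc]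
    -- Applying a after b evaluates the function component at x ◁ a, which produces the term ((x ◁
    -- a) ▷ b) w required by the rule for x ▷ [a, b]; the mixed terms a f(x ◁ b) and b f(x ◁ a)
    -- cancel.
    · simp only [LieRing.of_associative_ring_bracket, LinearMap.sub_apply, Module.End.mul_apply,
        Prod.snd_sub, prodAction_snd, prodAction_fst, M.lact_lie, M.ract_lie, map_add, map_sub,
        inl_lie, sub_mul, add_mul, mul_add, mul_assoc]
      abel

/-- The first component only records the current vector u w, which the recursion for the second
component needs. -/
theorem lift_prodActionHom_fst (u : UniversalEnvelopingAlgebra k 𝔤) (p) :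
    (lift k M.prodActionHom u p).1 = (u ⊗ₜ 1) * p.1 := by
  induction u using left_induction with
  | one => simp [← Algebra.TensorProduct.one_def]
  | smul r u hu => simp only [map_smul, LinearMap.smul_apply, Prod.smul_fst, hu, ← smul_tmul',
      smul_mul_assoc]
  | add u v hu hv => simp only [map_add, LinearMap.add_apply, Prod.fst_add, hu, hv, add_tmul,
      add_mul]
  | ι_mul a u hu =>
    rw [map_mul, Module.End.mul_apply, lift_ι_apply]
    change (M.prodAction a _).1 = _
    rw [prodAction_fst, hu, inl_apply, ← mul_assoc, Algebra.TensorProduct.tmul_mul_tmul, mul_one]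

/-- The starting vectors `(1 ⊗ y, x ↦ 1 ⊗ x y)`. -/
def initial : UniversalEnvelopingAlgebra k 𝔥 →ₗ[k]
    ((UniversalEnvelopingAlgebra k 𝔤 ⊗[k] UniversalEnvelopingAlgebra k 𝔥) ×
      (𝔥 →ₗ[k] UniversalEnvelopingAlgebra k 𝔤 ⊗[k] UniversalEnvelopingAlgebra k 𝔥)) :=
  (TensorProduct.mk k _ _ 1).prod
    (LinearMap.flip ((LinearMap.mul k _ ∘ₗ (ι k : 𝔥 →ₗ⁅k⁆ _).toLinearMap).compr₂
      (TensorProduct.mk k (UniversalEnvelopingAlgebra k 𝔤) _ 1)))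

theorem initial_fst (y : UniversalEnvelopingAlgebra k 𝔥) :
    (initial (𝔤 := 𝔤) y).1 = 1 ⊗ₜ y := rfl

theorem initial_snd (y : UniversalEnvelopingAlgebra k 𝔥) (x : 𝔥) :
    (initial (𝔤 := 𝔤) y).2 x = 1 ⊗ₜ (ι k x * y) := rfl

/-- The action of `𝔥` on `U(𝔤) ⊗ U(𝔥)`, as a linear map. -/
def act : 𝔥 →ₗ[k]
    Module.End k (UniversalEnvelopingAlgebra k 𝔤 ⊗[k] UniversalEnvelopingAlgebra k 𝔥) :=
  LinearMap.flip (LinearMap.snd k _ _ ∘ₗ TensorProduct.lift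
    ((LinearMap.lcomp k _ (initial (k := k) (𝔤 := 𝔤) (𝔥 := 𝔥))) ∘ₗ
      (lift k M.prodActionHom).toLinearMap))

theorem act_tmul (x : 𝔥) (u : UniversalEnvelopingAlgebra k 𝔤) (y : UniversalEnvelopingAlgebra k 𝔥) :
    M.act x (u ⊗ₜ y) = (lift k M.prodActionHom u (initial y)).2 x := rfl

@[simp] theorem act_one_tmul (x : 𝔥) (y : UniversalEnvelopingAlgebra k 𝔥) :
    M.act x (1 ⊗ₜ y) = 1 ⊗ₜ (ι k x * y) := by
  rw [act_tmul, map_one, Module.End.one_apply, initial_snd]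

/-- The defining recursion of the action. It expresses the bracket [x, a] = x ▷ a + x ◁ a of the
bicrossed sum of 𝔤 and 𝔥. -/
theorem act_inl_mul (x : 𝔥) (a : 𝔤)
    (w : UniversalEnvelopingAlgebra k 𝔤 ⊗[k] UniversalEnvelopingAlgebra k 𝔥) :
    M.act x (inl k 𝔤 𝔥 a * w) =
      inl k 𝔤 𝔥 (M.lact x a) * w + inl k 𝔤 𝔥 a * M.act x w + M.act (M.ract x a) w := by
  induction w with
  | zero => simp
  | add u v hu hv => simp only [mul_add, map_add, hu, hv]; abel
  | tmul u y =>
    rw [inl_apply, Algebra.TensorProduct.tmul_mul_tmul, one_mul, act_tmul, map_mul,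
      Module.End.mul_apply, lift_ι_apply]
    change (M.prodAction a _).2 x = _
    rw [prodAction_snd, lift_prodActionHom_fst, ← act_tmul, ← act_tmul, initial_fst,
      Algebra.TensorProduct.tmul_mul_tmul, one_mul, mul_one]
    rfl

/-- The action of `𝔥` on `U(𝔤) ⊗ U(𝔥)`. -/
def actHom : 𝔥 →ₗ⁅k⁆
    Module.End k (UniversalEnvelopingAlgebra k 𝔤 ⊗[k] UniversalEnvelopingAlgebra k 𝔥) :=
  { M.act with
    map_lie' := fun {x y} => by
      refine LinearMap.ext fun w => ?_
      change M.act ⁅x, y⁆ w = _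
      change _ = (⁅M.act x, M.act y⁆ : Module.End k _) w
      simp only [LieRing.of_associative_ring_bracket, LinearMap.sub_apply, Module.End.mul_apply]
      -- The recursion replaces x by x ◁ a and y by y ◁ a, so the hypothesis is needed for all
      -- pairs.
      induction w using tensor_induction generalizing x y with
      | add u v hu hv => simp only [map_add, hu, hv]; abel
      | one_tmul z => simp only [act_one_tmul, ι_lie, sub_mul, tmul_sub, mul_assoc]
      | inl_mul a w hw =>
        simp only [act_inl_mul, M.lie_lact, M.lie_ract, map_add, map_sub, LinearMap.add_apply,
          LinearMap.sub_apply, hw, sub_mul, mul_sub]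
        abel }

/-- The action of `U(𝔥)` on `U(𝔤) ⊗ U(𝔥)`. -/
def actLift : UniversalEnvelopingAlgebra k 𝔥 →ₐ[k]
    Module.End k (UniversalEnvelopingAlgebra k 𝔤 ⊗[k] UniversalEnvelopingAlgebra k 𝔥) :=
  lift k M.actHom

theorem actLift_ι (x : 𝔥) : M.actLift (ι k x) = M.act x := lift_ι_apply _ _ _

theorem actLift_one_tmul (x y : UniversalEnvelopingAlgebra k 𝔥) :
    M.actLift x (1 ⊗ₜ y) = 1 ⊗ₜ (x * y) := by
  induction x using left_induction with
  | one => simp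
  | smul r u hu => simp only [map_smul, LinearMap.smul_apply, hu, smul_mul_assoc, tmul_smul]
  | add u v hu hv => simp only [map_add, LinearMap.add_apply, hu, hv, add_mul, tmul_add]
  | ι_mul x u hu => rw [map_mul, Module.End.mul_apply, hu, actLift_ι, act_one_tmul, mul_assoc]

/-! ### The product on U(𝔤) ⊗ U(𝔥) and its associativity -/

/-- The product `(a ⊗ x) w = a (x w)` on `U(𝔤) ⊗ U(𝔥)`. -/
def mulMap : UniversalEnvelopingAlgebra k 𝔤 ⊗[k] UniversalEnvelopingAlgebra k 𝔥 →ₗ[k]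
    UniversalEnvelopingAlgebra k 𝔤 ⊗[k] UniversalEnvelopingAlgebra k 𝔥 →ₗ[k]
      UniversalEnvelopingAlgebra k 𝔤 ⊗[k] UniversalEnvelopingAlgebra k 𝔥 :=
  TensorProduct.lift ((LinearMap.mul k (Module.End k _)).compl₁₂
    (LinearMap.mul k _ ∘ₗ (TensorProduct.mk k _ _).flip 1) M.actLift.toLinearMap)

theorem mulMap_tmul (a : UniversalEnvelopingAlgebra k 𝔤) (x : UniversalEnvelopingAlgebra k 𝔥) (w) :
    M.mulMap (a ⊗ₜ x) w = (a ⊗ₜ 1) * M.actLift x w := rfl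

theorem mulMap_inl_mul (a : 𝔤) (v w) :
    M.mulMap (inl k 𝔤 𝔥 a * v) w = inl k 𝔤 𝔥 a * M.mulMap v w := by
  induction v with
  | zero => simp
  | add u v hu hv => simp only [mul_add, map_add, LinearMap.add_apply, hu, hv]
  | tmul u y =>
    rw [inl_apply, Algebra.TensorProduct.tmul_mul_tmul, mulMap_tmul, mulMap_tmul, ← mul_assoc,
      Algebra.TensorProduct.tmul_mul_tmul, mul_one, one_mul]

theorem mulMap_one_tmul_left (x : UniversalEnvelopingAlgebra k 𝔥) (w) :
    M.mulMap (1 ⊗ₜ x) w = M.actLift x w := by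
  rw [mulMap_tmul, ← Algebra.TensorProduct.one_def, one_mul]

/-- The action of 𝔥 commutes with right multiplications, as both sides obey the same recursion in v.
Associativity follows by extending this from 𝔥 to U(𝔥) and then multiplying by U(𝔤). -/
theorem act_mulMap (x : 𝔥) (v w) : M.act x (M.mulMap v w) = M.mulMap (M.act x v) w := by
  induction v using tensor_induction generalizing x with
  | add u v hu hv => simp only [map_add, LinearMap.add_apply, hu, hv]
  | one_tmul y =>
    rw [act_one_tmul, mulMap_one_tmul_left, mulMap_one_tmul_left, map_mul, Module.End.mul_apply,
      actLift_ι]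
  | inl_mul a v hv =>
    simp only [act_inl_mul, mulMap_inl_mul, map_add, LinearMap.add_apply, hv]

theorem actLift_mulMap (x : UniversalEnvelopingAlgebra k 𝔥) (v w) :
    M.actLift x (M.mulMap v w) = M.mulMap (M.actLift x v) w := by
  induction x using left_induction with
  | one => simp
  | smul r u hu => simp only [map_smul, LinearMap.smul_apply, hu]
  | add u v hu hv => simp only [map_add, LinearMap.add_apply, hu, hv]
  | ι_mul x u hu => simp only [map_mul, Module.End.mul_apply, hu, actLift_ι, act_mulMap]

theorem mulMap_assoc (u v w) : M.mulMap (M.mulMap u v) w = M.mulMap u (M.mulMap v w) := by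
  induction u using tensor_induction with
  | add u v hu hv => simp only [map_add, LinearMap.add_apply, hu, hv]
  | one_tmul y => rw [mulMap_one_tmul_left, mulMap_one_tmul_left, actLift_mulMap]
  | inl_mul a u hu => simp only [mulMap_inl_mul, hu]

theorem mulMap_tmul_one (a : UniversalEnvelopingAlgebra k 𝔤) (w) :
    M.mulMap (a ⊗ₜ 1) w = (a ⊗ₜ 1) * w := by
  rw [mulMap_tmul, map_one, Module.End.one_apply]

theorem mulMap_one_tmul (w) (y : UniversalEnvelopingAlgebra k 𝔥) :
    M.mulMap w (1 ⊗ₜ y) = w * (1 ⊗ₜ y) := by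
  induction w with
  | zero => simp
  | add u v hu hv => simp only [add_mul, map_add, LinearMap.add_apply, hu, hv]
  | tmul a x => simp [mulMap_tmul, actLift_one_tmul]

/-! ### Compatibility of the product with comultiplication and counit -/

theorem comul_inl_mul (a : 𝔤) (w) : comul (R := k) (inl k 𝔤 𝔥 a * w) =
    (inl k 𝔤 𝔥 a ⊗ₜ 1) * comul w + (1 ⊗ₜ inl k 𝔤 𝔥 a) * comul w := by
  rw [Bialgebra.comul_mul, ← add_mul, inl_apply, comul_tmul_one, comul_ι]
  simp [Algebra.TensorProduct.one_def]

theorem counit_inl_mul (a : 𝔤) (w) : counit (R := k) (inl k 𝔤 𝔥 a * w) = 0 := by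
  rw [Bialgebra.counit_mul, inl_apply, TensorProduct.counit_tmul, counit_ι, smul_zero, zero_mul]

theorem act_rTensor_inl_mul (x : 𝔥) (a : 𝔤)
    (z : (UniversalEnvelopingAlgebra k 𝔤 ⊗[k] UniversalEnvelopingAlgebra k 𝔥) ⊗[k]
      (UniversalEnvelopingAlgebra k 𝔤 ⊗[k] UniversalEnvelopingAlgebra k 𝔥)) :
    (M.act x).rTensor _ ((inl k 𝔤 𝔥 a ⊗ₜ 1) * z) =
      (inl k 𝔤 𝔥 (M.lact x a) ⊗ₜ 1) * z + (inl k 𝔤 𝔥 a ⊗ₜ 1) * (M.act x).rTensor _ z +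
        (M.act (M.ract x a)).rTensor _ z := by
  induction z with
  | zero => simp
  | add u v hu hv => simp only [mul_add, map_add, hu, hv]; abel
  | tmul u v =>
    simp only [LinearMap.rTensor_tmul, Algebra.TensorProduct.tmul_mul_tmul, one_mul, act_inl_mul,
      add_tmul]

theorem act_lTensor_inl_mul (x : 𝔥) (a : 𝔤)
    (z : (UniversalEnvelopingAlgebra k 𝔤 ⊗[k] UniversalEnvelopingAlgebra k 𝔥) ⊗[k]
      (UniversalEnvelopingAlgebra k 𝔤 ⊗[k] UniversalEnvelopingAlgebra k 𝔥)) :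
    (M.act x).lTensor _ ((1 ⊗ₜ inl k 𝔤 𝔥 a) * z) =
      (1 ⊗ₜ inl k 𝔤 𝔥 (M.lact x a)) * z + (1 ⊗ₜ inl k 𝔤 𝔥 a) * (M.act x).lTensor _ z +
        (M.act (M.ract x a)).lTensor _ z := by
  induction z with
  | zero => simp
  | add u v hu hv => simp only [mul_add, map_add, hu, hv]; abel
  | tmul u v =>
    simp only [LinearMap.lTensor_tmul, Algebra.TensorProduct.tmul_mul_tmul, one_mul, act_inl_mul,
      tmul_add]

theorem act_rTensor_mul_of_right (x : 𝔥) (a : 𝔤) (z) :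
    (M.act x).rTensor _ ((1 ⊗ₜ inl k 𝔤 𝔥 a) * z) =
      (1 ⊗ₜ inl k 𝔤 𝔥 a) * (M.act x).rTensor _ z := by
  induction z with
  | zero => simp
  | add u v hu hv => simp only [mul_add, map_add, hu, hv]
  | tmul u v => simp only [LinearMap.rTensor_tmul, Algebra.TensorProduct.tmul_mul_tmul, one_mul]

theorem act_lTensor_mul_of_left (x : 𝔥) (a : 𝔤) (z) :
    (M.act x).lTensor _ ((inl k 𝔤 𝔥 a ⊗ₜ 1) * z) =
      (inl k 𝔤 𝔥 a ⊗ₜ 1) * (M.act x).lTensor _ z := by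
  induction z with
  | zero => simp
  | add u v hu hv => simp only [mul_add, map_add, hu, hv]
  | tmul u v => simp only [LinearMap.lTensor_tmul, Algebra.TensorProduct.tmul_mul_tmul, one_mul]

/-- A primitive x acts as a coderivation. The recursion preserves this: a and x on the same leg
follow `act_inl_mul`, and on different legs they commute. -/
theorem comul_act (x : 𝔥) (w) : comul (R := k) (M.act x w) =
    (M.act x).rTensor _ (comul w) + (M.act x).lTensor _ (comul w) := by
  induction w using tensor_induction generalizing x with
  | add u v hu hv => simp only [map_add, hu, hv]; abel
  | one_tmul y =>
    rw [act_one_tmul, comul_one_tmul, comul_one_tmul, Bialgebra.comul_mul, comul_ι, add_mul]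
    induction (comul y : UniversalEnvelopingAlgebra k 𝔥 ⊗[k] UniversalEnvelopingAlgebra k 𝔥) with
    | zero => simp
    | add u v hu hv =>
      simp only [mul_add, map_add] at hu hv ⊢
      rw [add_add_add_comm, hu, hv]; abel
    | tmul u v => simp [-ι_apply]
  | inl_mul a w hw =>
    simp only [act_inl_mul, comul_inl_mul, map_add, hw, act_rTensor_inl_mul, act_lTensor_inl_mul,
      act_rTensor_mul_of_right, act_lTensor_mul_of_left, mul_add]
    abel

theorem counit_act (x : 𝔥) (w) : counit (R := k) (M.act x w) = 0 := by
  induction w using tensor_induction generalizing x with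
  | add u v hu hv => simp only [map_add, hu, hv, add_zero]
  | one_tmul y => simp [-ι_apply, counit_ι]
  | inl_mul a w hw => simp only [act_inl_mul, map_add, counit_inl_mul, hw, add_zero]

/-- The coderivation property of the generators extends to U(𝔥) because Δ is multiplicative there.
-/
theorem comul_actLift (x : UniversalEnvelopingAlgebra k 𝔥) (w) :
    comul (R := k) (M.actLift x w) =
      TensorProduct.map₂ M.actLift.toLinearMap M.actLift.toLinearMap (comul x) (comul w) := by
  induction x using left_induction with
  | one => simp [Algebra.TensorProduct.one_def, Module.End.one_eq_id]
  | smul r u hu => simp only [map_smul, LinearMap.smul_apply, hu]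
  | add u v hu hv => simp only [map_add, LinearMap.add_apply, hu, hv]
  | ι_mul x u hu =>
    rw [map_mul, Module.End.mul_apply, actLift_ι, comul_act, hu, Bialgebra.comul_mul, comul_ι]
    generalize (comul u : UniversalEnvelopingAlgebra k 𝔥 ⊗[k] UniversalEnvelopingAlgebra k 𝔥) = p
    generalize comul (R := k) w = z
    induction p with
    | zero => simp
    | add u v hu hv =>
      simp only [mul_add, map_add, LinearMap.add_apply] at hu hv ⊢
      rw [← hu, ← hv]; abel
    | tmul u v =>
      induction z with
      | zero => simp
      | add u v hu hv =>
        simp only [map_add] at hu hv ⊢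
        rw [← hu, ← hv]; abel
      | tmul w w' => simp [-ι_apply, add_mul, actLift_ι]

theorem counit_actLift (x : UniversalEnvelopingAlgebra k 𝔥) (w) :
    counit (R := k) (M.actLift x w) = counit (R := k) x * counit (R := k) w := by
  induction x using left_induction with
  | one => simp
  | smul r u hu => simp only [map_smul, LinearMap.smul_apply, hu, smul_mul_assoc]
  | add u v hu hv => simp only [map_add, LinearMap.add_apply, hu, hv, add_mul]
  | ι_mul x u hu => simp [-ι_apply, actLift_ι, counit_act, counit_ι]

theorem comul_mulMap (u v) : comul (R := k) (M.mulMap u v) =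
    TensorProduct.map₂ M.mulMap M.mulMap (comul u) (comul v) := by
  induction u using tensor_induction with
  | add u v hu hv => simp only [map_add, LinearMap.add_apply, hu, hv]
  | one_tmul y =>
    rw [mulMap_one_tmul_left, comul_actLift, comul_one_tmul]
    induction (comul y : UniversalEnvelopingAlgebra k 𝔥 ⊗[k] UniversalEnvelopingAlgebra k 𝔥) with
    | zero => simp
    | add u v hu hv => simp only [map_add, LinearMap.add_apply, hu, hv]
    | tmul x y =>
      rw [TensorProduct.map_tmul, TensorProduct.map₂_apply_tmul, TensorProduct.map₂_apply_tmul]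
      congr 2 <;> exact LinearMap.ext fun w => (M.mulMap_one_tmul_left _ w).symm
  | inl_mul a u hu =>
    rw [mulMap_inl_mul, comul_inl_mul, comul_inl_mul, hu]
    generalize comul (R := k) u = p
    generalize comul (R := k) v = z
    induction p with
    | zero => simp
    | add u v hu hv =>
      simp only [mul_add, map_add, LinearMap.add_apply] at hu hv ⊢
      rw [add_add_add_comm, hu, hv]; abel
    | tmul u v =>
      induction z with
      | zero => simp
      | add u v hu hv =>
        simp only [map_add, mul_add, LinearMap.add_apply] at hu hv ⊢
        rw [add_add_add_comm, hu, hv]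
      | tmul w w' => simp [mulMap_inl_mul]

theorem counit_mulMap (u v) : counit (R := k) (M.mulMap u v) =
    counit (R := k) u * counit (R := k) v := by
  induction u using tensor_induction with
  | add u v hu hv => simp only [map_add, LinearMap.add_apply, hu, hv, add_mul]
  | one_tmul y => simp [mulMap_one_tmul_left, counit_actLift]
  | inl_mul a u hu => rw [mulMap_inl_mul, counit_inl_mul, counit_inl_mul, zero_mul]

/-! ### The resulting matched pair and its uniqueness -/

/-- The bicrossed product of universal enveloping algebras. -/
def bicrossedProduct :
    BicrossedProduct k (UniversalEnvelopingAlgebra k 𝔤) (UniversalEnvelopingAlgebra k 𝔥) where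
  mul := M.mulMap
  mul_assoc := M.mulMap_assoc
  tmul_one_mul := M.mulMap_tmul_one
  mul_one_tmul := M.mulMap_one_tmul
  comul_mul := M.comul_mulMap
  counit_mul := M.counit_mulMap

theorem bicrossedProduct_mul_ι (x : 𝔥) (a : 𝔤) :
    M.bicrossedProduct.mul (1 ⊗ₜ ι k x) (ι k a ⊗ₜ 1) =
      ι k (M.lact x a) ⊗ₜ 1 + ι k a ⊗ₜ ι k x + 1 ⊗ₜ ι k (M.ract x a) := by
  have := M.act_inl_mul x a (1 ⊗ₜ 1)
  rw [act_one_tmul, act_one_tmul, inl_apply, inl_apply] at this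
  simp only [Algebra.TensorProduct.tmul_mul_tmul, mul_one, one_mul] at this
  rw [← this, ← actLift_ι, ← mulMap_one_tmul_left]
  rfl

theorem bicrossedProduct_lact_ι (x : 𝔥) (a : 𝔤) :
    M.bicrossedProduct.lact (ι k x ⊗ₜ ι k a) = ι k (M.lact x a) := by
  rw [BicrossedProduct.lact_tmul, bicrossedProduct_mul_ι]
  simp [-ι_apply, counit_ι]

theorem bicrossedProduct_ract_ι (x : 𝔥) (a : 𝔤) :
    M.bicrossedProduct.ract (ι k x ⊗ₜ ι k a) = ι k (M.ract x a) := by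
  rw [BicrossedProduct.ract_tmul, bicrossedProduct_mul_ι]
  simp [-ι_apply, counit_ι]

/-- Since x is primitive, the twist is (x ▷ u₁) ⊗ (1 ◁ u₂) + (1 ▷ u₁) ⊗ (x ◁ u₂), and the counit
collapses the first summand. -/
theorem actTwist_ι_tmul (P : HopfMatchedPair k (UniversalEnvelopingAlgebra k 𝔤)
    (UniversalEnvelopingAlgebra k 𝔥)) (x : 𝔥) (u : UniversalEnvelopingAlgebra k 𝔤) :
    actTwist (P.lact : _ →ₗ[k] UniversalEnvelopingAlgebra k 𝔤)
        (P.ract : _ →ₗ[k] UniversalEnvelopingAlgebra k 𝔥) (ι k x ⊗ₜ u) =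
      P.lact (ι k x ⊗ₜ u) ⊗ₜ 1 +
        ((P.ract : _ →ₗ[k] UniversalEnvelopingAlgebra k 𝔥) ∘ₗ
          TensorProduct.mk k _ _ (ι k x)).lTensor _ (comul u) := by
  have key : ∀ p : UniversalEnvelopingAlgebra k 𝔤 ⊗[k] UniversalEnvelopingAlgebra k 𝔤,
      TensorProduct.map (P.lact : _ →ₗ[k] UniversalEnvelopingAlgebra k 𝔤)
        (P.ract : _ →ₗ[k] UniversalEnvelopingAlgebra k 𝔥)
        (tensorTensorTensorComm k _ _ _ _ ((ι k x ⊗ₜ 1 + 1 ⊗ₜ ι k x) ⊗ₜ p)) =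
      P.lact (ι k x ⊗ₜ TensorProduct.rid k _ (counit.lTensor _ p)) ⊗ₜ 1 +
        ((P.ract : _ →ₗ[k] UniversalEnvelopingAlgebra k 𝔥) ∘ₗ
          TensorProduct.mk k _ _ (ι k x)).lTensor _ p := by
    intro p
    induction p with
    | zero => simp
    | add u v hu hv =>
      simp only [tmul_add, map_add, hu, hv]
      rw [add_tmul]
      abel
    | tmul a b =>
      simp [-ι_apply, add_tmul, P.one_lact, P.one_ract]
      rw [smul_tmul']
  have h := key (comul u)
  rw [Coalgebra.lTensor_counit_comul, TensorProduct.rid_tmul, one_smul, ← comul_ι] at h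
  exact h

variable {M}

/-- The twist of x ⊗ a is x ▷ a ⊗ 1 + a ⊗ x + 1 ⊗ x ◁ a, so the product rule for ▷ becomes the
recursion that defined the action of 𝔥. -/
theorem lact_ι_ι_mul {P : HopfMatchedPair k (UniversalEnvelopingAlgebra k 𝔤)
    (UniversalEnvelopingAlgebra k 𝔥)}
    (hP : ∀ (x : 𝔥) (a : 𝔤), P.lact (ι k x ⊗ₜ ι k a) = ι k (M.lact x a) ∧
      P.ract (ι k x ⊗ₜ ι k a) = ι k (M.ract x a))
    (x : 𝔥) (a : 𝔤) (u : UniversalEnvelopingAlgebra k 𝔤) :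
    P.lact (ι k x ⊗ₜ (ι k a * u)) =
      ι k (M.lact x a) * u + ι k a * P.lact (ι k x ⊗ₜ u) + P.lact (ι k (M.ract x a) ⊗ₜ u) := by
  rw [P.lact_mul, actTwist_ι_tmul, comul_ι, (hP x a).1]
  simp [-ι_apply, P.one_lact, P.ract_one, (hP x a).2, add_assoc]

theorem hopfMatchedPair_ext {P P' : HopfMatchedPair k (UniversalEnvelopingAlgebra k 𝔤)
    (UniversalEnvelopingAlgebra k 𝔥)}
    (hP : ∀ (x : 𝔥) (a : 𝔤), P.lact (ι k x ⊗ₜ ι k a) = ι k (M.lact x a) ∧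
      P.ract (ι k x ⊗ₜ ι k a) = ι k (M.ract x a))
    (hP' : ∀ (x : 𝔥) (a : 𝔤), P'.lact (ι k x ⊗ₜ ι k a) = ι k (M.lact x a) ∧
      P'.ract (ι k x ⊗ₜ ι k a) = ι k (M.ract x a)) : P = P' := by
  -- The image of 𝔥 is stable under ◁. One witness y serves both matched pairs, so that in a product
  -- u v the action of v starts from the same element of 𝔥.
  have ract_ι : ∀ (u : UniversalEnvelopingAlgebra k 𝔤) (x : 𝔥), ∃ y : 𝔥,
      P.ract (ι k x ⊗ₜ u) = ι k y ∧ P'.ract (ι k x ⊗ₜ u) = ι k y := by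
    intro u
    induction u using induction_ι k 𝔤 with
    | hr r =>
      refine fun x => ⟨r • x, ?_⟩
      simp only [Algebra.algebraMap_eq_smul_one, tmul_smul, map_smul, P.ract_one, P'.ract_one,
        and_self]
    | hι a => exact fun x => ⟨_, (hP x a).2, (hP' x a).2⟩
    | hadd u v hu hv =>
      intro x
      obtain ⟨y, h1, h2⟩ := hu x
      obtain ⟨z, h3, h4⟩ := hv x
      exact ⟨y + z, by simp only [tmul_add, map_add, h1, h3],
        by simp only [tmul_add, map_add, h2, h4]⟩
    | hmul u v hu hv =>
      intro x
      obtain ⟨y, h1, h2⟩ := hu x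
      obtain ⟨z, h3, h4⟩ := hv y
      exact ⟨z, by rw [P.ract_mul, h1, h3], by rw [P'.ract_mul, h2, h4]⟩
  have lact_ι : ∀ (u : UniversalEnvelopingAlgebra k 𝔤) (x : 𝔥),
      P.lact (ι k x ⊗ₜ u) = P'.lact (ι k x ⊗ₜ u) := by
    intro u
    induction u using left_induction with
    | one => intro x; rw [P.lact_one, P'.lact_one]
    | smul r u hu => intro x; simp only [tmul_smul, map_smul, hu]
    | add u v hu hv => intro x; simp only [tmul_add, map_add, hu, hv]
    | ι_mul a u hu => intro x; rw [lact_ι_ι_mul hP, lact_ι_ι_mul hP', hu, hu]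
  have lact_eq : ∀ (x : UniversalEnvelopingAlgebra k 𝔥) (u : UniversalEnvelopingAlgebra k 𝔤),
      P.lact (x ⊗ₜ u) = P'.lact (x ⊗ₜ u) := by
    intro x
    induction x using left_induction with
    | one => intro u; rw [P.one_lact, P'.one_lact]
    | smul r x hx => intro u; simp only [← smul_tmul', map_smul, hx]
    | add x y hx hy => intro u; simp only [add_tmul, map_add, hx, hy]
    | ι_mul x y hy => intro u; rw [P.mul_lact, P'.mul_lact, hy, lact_ι]
  have ract_eq : ∀ (x : UniversalEnvelopingAlgebra k 𝔥) (u : UniversalEnvelopingAlgebra k 𝔤),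
      P.ract (x ⊗ₜ u) = P'.ract (x ⊗ₜ u) := by
    intro x
    -- Right multiplication fits the rule for (y x) ◁ u, which twists only the last factor x ∈ 𝔥,
    -- where the twist is explicit.
    induction x using right_induction with
    | one => intro u; rw [P.one_ract, P'.one_ract]
    | smul r x hx => intro u; simp only [← smul_tmul', map_smul, hx]
    | add x y hx hy => intro u; simp only [add_tmul, map_add, hx, hy]
    | mul_ι y x hy =>
      intro u
      have e1 : ((P.ract : UniversalEnvelopingAlgebra k 𝔥 ⊗[k] UniversalEnvelopingAlgebra k 𝔤 →ₗ[k] UniversalEnvelopingAlgebra k 𝔥) ∘ₗ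
          TensorProduct.mk k (UniversalEnvelopingAlgebra k 𝔥) (UniversalEnvelopingAlgebra k 𝔤) y) =
          ((P'.ract : UniversalEnvelopingAlgebra k 𝔥 ⊗[k] UniversalEnvelopingAlgebra k 𝔤 →ₗ[k] UniversalEnvelopingAlgebra k 𝔥) ∘ₗ
          TensorProduct.mk k (UniversalEnvelopingAlgebra k 𝔥) (UniversalEnvelopingAlgebra k 𝔤) y) :=
        LinearMap.ext hy
      have e2 : ((P.ract : UniversalEnvelopingAlgebra k 𝔥 ⊗[k] UniversalEnvelopingAlgebra k 𝔤 →ₗ[k] UniversalEnvelopingAlgebra k 𝔥) ∘ₗ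
          TensorProduct.mk k (UniversalEnvelopingAlgebra k 𝔥) (UniversalEnvelopingAlgebra k 𝔤) (ι k x)) =
          ((P'.ract : UniversalEnvelopingAlgebra k 𝔥 ⊗[k] UniversalEnvelopingAlgebra k 𝔤 →ₗ[k] UniversalEnvelopingAlgebra k 𝔥) ∘ₗ
          TensorProduct.mk k (UniversalEnvelopingAlgebra k 𝔥) (UniversalEnvelopingAlgebra k 𝔤) (ι k x)) :=
        LinearMap.ext fun u => by
          obtain ⟨z, h1, h2⟩ := ract_ι u x
          exact h1.trans h2.symm
      rw [P.mul_ract, P'.mul_ract, actTwist_ι_tmul, actTwist_ι_tmul, lact_eq, e1, e2]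
  refine HopfMatchedPair.ext (CoalgHom.ext fun w => ?_) (CoalgHom.ext fun w => ?_)
  · induction w with
    | zero => simp
    | add u v hu hv => simp only [map_add, hu, hv]
    | tmul x u => exact lact_eq x u
  · induction w with
    | zero => simp
    | add u v hu hv => simp only [map_add, hu, hv]
    | tmul x u => exact ract_eq x u

end LieMatchedPair

end

/-! ### The theorem for groups and for Lie algebras -/

theorem mainTheorem10 (k : Type*) [Field k] :
    (∀ (G H : Type*) [Group G] [Group H] (M : GroupMatchedPair G H),
      Coalgebra.IsCocomm k (MonoidAlgebra k G) ∧ Coalgebra.IsCocomm k (MonoidAlgebra k H) ∧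
      ∃ P : HopfMatchedPair k (MonoidAlgebra k G) (MonoidAlgebra k H),
        (∀ (h : H) (g : G),
          P.lact (MonoidAlgebra.of k H h ⊗ₜ MonoidAlgebra.of k G g) =
              MonoidAlgebra.of k G (M.lact h g) ∧
            P.ract (MonoidAlgebra.of k H h ⊗ₜ MonoidAlgebra.of k G g) =
              MonoidAlgebra.of k H (M.ract h g)) ∧
        (∀ P' : HopfMatchedPair k (MonoidAlgebra k G) (MonoidAlgebra k H),
          (∀ (h : H) (g : G),
            P'.lact (MonoidAlgebra.of k H h ⊗ₜ MonoidAlgebra.of k G g) =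
                MonoidAlgebra.of k G (M.lact h g) ∧
              P'.ract (MonoidAlgebra.of k H h ⊗ₜ MonoidAlgebra.of k G g) =
                MonoidAlgebra.of k H (M.ract h g)) → P' = P) ∧
        ∃ B : HopfBrace k (MonoidAlgebra k G ⊗[k] MonoidAlgebra k H),
          B.IsCocommutative ∧
          (∀ (a b : MonoidAlgebra k G) (x y : MonoidAlgebra k H),
            B.dot.mul (a ⊗ₜ x) (b ⊗ₜ y) = P.bicrossedMul a x b y) ∧
          (∀ (a b : MonoidAlgebra k G) (x y : MonoidAlgebra k H),
            B.circ.mul (a ⊗ₜ x) (b ⊗ₜ y) = (a * b) ⊗ₜ (y * x))) ∧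
    (∀ (𝔤 𝔥 : Type*) [LieRing 𝔤] [LieAlgebra k 𝔤] [LieRing 𝔥] [LieAlgebra k 𝔥]
      (M : LieMatchedPair k 𝔤 𝔥),
      Coalgebra.IsCocomm k (UniversalEnvelopingAlgebra k 𝔤) ∧
      Coalgebra.IsCocomm k (UniversalEnvelopingAlgebra k 𝔥) ∧
      ∃ P : HopfMatchedPair k (UniversalEnvelopingAlgebra k 𝔤) (UniversalEnvelopingAlgebra k 𝔥),
        (∀ (x : 𝔥) (a : 𝔤),
          P.lact (UniversalEnvelopingAlgebra.ι k x ⊗ₜ UniversalEnvelopingAlgebra.ι k a) =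
              UniversalEnvelopingAlgebra.ι k (M.lact x a) ∧
            P.ract (UniversalEnvelopingAlgebra.ι k x ⊗ₜ UniversalEnvelopingAlgebra.ι k a) =
              UniversalEnvelopingAlgebra.ι k (M.ract x a)) ∧
        (∀ P' : HopfMatchedPair k (UniversalEnvelopingAlgebra k 𝔤)
            (UniversalEnvelopingAlgebra k 𝔥),
          (∀ (x : 𝔥) (a : 𝔤),
            P'.lact (UniversalEnvelopingAlgebra.ι k x ⊗ₜ UniversalEnvelopingAlgebra.ι k a) =
                UniversalEnvelopingAlgebra.ι k (M.lact x a) ∧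
              P'.ract (UniversalEnvelopingAlgebra.ι k x ⊗ₜ UniversalEnvelopingAlgebra.ι k a) =
                UniversalEnvelopingAlgebra.ι k (M.ract x a)) → P' = P) ∧
        ∃ B : HopfBrace k (UniversalEnvelopingAlgebra k 𝔤 ⊗[k] UniversalEnvelopingAlgebra k 𝔥),
          B.IsCocommutative ∧
          (∀ (a b : UniversalEnvelopingAlgebra k 𝔤) (x y : UniversalEnvelopingAlgebra k 𝔥),
            B.dot.mul (a ⊗ₜ x) (b ⊗ₜ y) = P.bicrossedMul a x b y) ∧
          (∀ (a b : UniversalEnvelopingAlgebra k 𝔤) (x y : UniversalEnvelopingAlgebra k 𝔥),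
            B.circ.mul (a ⊗ₜ x) (b ⊗ₜ y) = (a * b) ⊗ₜ (y * x))) := by 
  refine ⟨fun G H _ _ M => ⟨inferInstance, inferInstance, (M.bicrossedProduct k).matchedPair,
      fun h g => ⟨M.bicrossedProduct_lact_of k g h, M.bicrossedProduct_ract_of k g h⟩,
      -- The elements h ⊗ g form a basis, so linearity alone gives uniqueness here.
      fun P' hP' => HopfMatchedPair.ext
        (GroupMatchedPair.coalgHom_ext fun h g =>
          (hP' h g).1.trans (M.bicrossedProduct_lact_of k g h).symm)
        (GroupMatchedPair.coalgHom_ext fun h g =>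
          (hP' h g).2.trans (M.bicrossedProduct_ract_of k g h).symm),
      (M.bicrossedProduct k).exists_hopfBrace⟩, ?_⟩
  intro 𝔤 𝔥 _ _ _ _ M
  have h : ∀ (x : 𝔥) (a : 𝔤), _ ∧ _ := fun x a =>
    ⟨M.bicrossedProduct_lact_ι x a, M.bicrossedProduct_ract_ι x a⟩
  exact ⟨inferInstance, inferInstance, M.bicrossedProduct.matchedPair, h,
    fun P' hP' => LieMatchedPair.hopfMatchedPair_ext hP' h,
    M.bicrossedProduct.exists_hopfBrace⟩
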